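/- \textbf{Setting.} There are $N$ plants and $M$ sensors. Plant $i$ has state dimension $n_i$, real drift matrix $A_i$, process noise intensity $W_i\succeq 0$, initial error covariance $\Sigma_{i,0}\succ 0$ and error weight $T_i\succeq 0$. Sensor $j$, when it observes plant $i$, has measurement matrix $C_{ij}$, noise intensity $V_{ij}\succ 0$ and cost rate $\kappa_{ij}\in\mathbb R$. Assume that for each $i$ the pair $(A_i,W_i^{1/2})$ is controllable, and that for some set $J_i$ of sensors the pair $(A_i,\tilde C_i)$ is detectable, where $\tilde C_i$ stacks the matrices $C_{ij}$, $j\in J_i$. Consider real arrays $p=(p_{ij})_{1\le i\le N,\,1\le j\le M}$ subject to $$0\le p_{ij}\le 1,\qquad \sum_{i=1}^N p_{ij}\le 1\ \ (1\le j\le M),\qquad \sum_{j=1}^M p_{ij}\le 1\ \ (1\le i\le N). \tag{1}$$ Optionally, the inequalities for all sensors $j$ are replaced by equalities (every sensor is always operated; then assume $M\le N$), and/or the inequalities for all plants $i$ are replaced by equalities (every plant is always observed; then assume $N\le M$). The same version of (1) is used throughout. An \emph{admissible schedule} $\pi$ consists of measurable functions $\pi_{ij}$ with $\pi_{ij}(t)\in\{0,1\}$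 such that $(\pi_{ij}(t))_{i,j}$ satisfies (1) for all $t\ge 0$. The error covariances of the optimal (Kalman--Bucy) filters under $\pi$ are the continuous solutions on $[0,\infty)$, in the integrated sense, of $$\dot\Sigma_i=A_i\Sigma_i+\Sigma_iA_i^T+W_i-\Sigma_i\Big(\sum_{j=1}^M\pi_{ij}(t)\,C_{ij}^TV_{ij}^{-1}C_{ij}\Big)\Sigma_i,\qquad \Sigma_i(0)=\Sigma_{i,0}.$$ Let $Z^*$ be the optimal value (infimum) of the program $$\inf_{Q_i,\,p_{ij}}\ \sum_{i=1}^N\Big\{\mathrm{Tr}(T_iQ_i^{-1})+\sum_{j=1}^M\kappa_{ij}p_{ij}\Big\}$$ over symmetric $Q_i\succ 0$ and arrays $p$ satisfying (1), subject to $$Q_iA_i+A_i^TQ_i+Q_iW_iQ_i-\sum_{j=1}^M p_{ij}C_{ij}^TV_{ij}^{-1}C_{ij}\preceq 0,\qquad 1\le i\le N. \tag{2}$$ \textbf{Statement.} (a) This program is convex (convex feasible set, convex objective on it), and $Z^*$ is finite. (b) It can be rewritten as the convex (semidefinite) program of minimizing the linear objective $\sum_{i}\{\mathrm{Tr}(T_iR_i)+\sum_{j}\kappa_{ij}p_{ij}\}$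 over symmetric $R_i$, $Q_i$ and arrays $p$ satisfying (1), subject to, for $1\le i\le N$, $$\begin{bmatrix}R_i&I\\ I&Q_i\end{bmatrix}\succ 0,\qquad \begin{bmatrix}Q_iA_i+A_i^TQ_i-\sum_{j}p_{ij}C_{ij}^TV_{ij}^{-1}C_{ij}&Q_iW_i^{1/2}\\ W_i^{1/2}Q_i&-I\end{bmatrix}\preceq 0 .$$ That is, $(Q,p)$ is feasible for the first program if and only if $(R,Q,p)$ is feasible for this one for some $R$, and both programs have the same optimal value $Z^*$. (c) For every admissible schedule $\pi$, with error covariances $\Sigma_i$, $$\limsup_{\tau\to\infty}\frac1\tau\int_0^\tau\sum_{i=1}^N\Big\{\mathrm{Tr}(T_i\Sigma_i(t))+\sum_{j=1}^M\kappa_{ij}\pi_{ij}(t)\Big\}\,dt\ \ge\ Z^*,$$ where the left-hand side may be $+\infty$. -/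

import Mathlib

/-- The data of a continuous-time sensor scheduling problem with `N` plants and `M` sensors.
Plant `i` has state dimension `n i`, drift matrix `A i`, process noise intensity `W i`, initial
error covariance `S0 i` and error weight `T i`.  When sensor `j` observes plant `i` the measurement
matrix is `C i j`, the measurement noise intensity is `V i j`, and a cost `κ i j` is paid per unit
of time. -/
structure SchedulingProblem (N M : ℕ) where
  n : Fin N → ℕ
  r : Fin N → Fin M → ℕ
  A : (i : Fin N) → Matrix (Fin (n i)) (Fin (n i)) ℝ
  W : (i : Fin N) → Matrix (Fin (n i)) (Fin (n i)) ℝ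
  S0 : (i : Fin N) → Matrix (Fin (n i)) (Fin (n i)) ℝ
  T : (i : Fin N) → Matrix (Fin (n i)) (Fin (n i)) ℝ
  C : (i : Fin N) → (j : Fin M) → Matrix (Fin (r i j)) (Fin (n i)) ℝ
  V : (i : Fin N) → (j : Fin M) → Matrix (Fin (r i j)) (Fin (r i j)) ℝ
  κ : Fin N → Fin M → ℝ

/-- A real square matrix is Hurwitz: all its complex eigenvalues have negative real part. -/
def IsHurwitz {ι : Type*} [Fintype ι] [DecidableEq ι] (A : Matrix ι ι ℝ) : Prop :=
  ∀ z ∈ spectrum ℂ (A.map (fun x : ℝ => (x : ℂ))), z.re < 0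

/-- The pair `(A, C)` is detectable: some output injection `A - L C` is Hurwitz. -/
def IsDetectable {ι ρ : Type*} [Fintype ι] [DecidableEq ι] [Fintype ρ]
    (A : Matrix ι ι ℝ) (C : Matrix ρ ι ℝ) : Prop :=
  ∃ L : Matrix ι ρ ℝ, IsHurwitz (A - L * C)

/-- The pair `(A, B)` is controllable: the matrix `[B, A B, …, A ^ (d - 1) B]` has rank `d`. -/
def IsControllable {d : ℕ} {ρ : Type*} [Fintype ρ]
    (A : Matrix (Fin d) (Fin d) ℝ) (B : Matrix (Fin d) ρ ℝ) : Prop :=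
  (Matrix.of fun (a : Fin d) (q : Fin d × ρ) => (A ^ (q.1 : ℕ) * B) a q.2).rank = d

section

open scoped MatrixOrder

/-- The positive semidefinite square root of a positive semidefinite real matrix. -/
noncomputable def matrixSqrt {d : ℕ} (W : Matrix (Fin d) (Fin d) ℝ) : Matrix (Fin d) (Fin d) ℝ :=
  CFC.sqrt W

end

/-- `matrixSqrt W` is indeed a positive semidefinite square root of `W`. -/
theorem matrixSqrt_spec {d : ℕ} {W : Matrix (Fin d) (Fin d) ℝ} (hW : W.PosSemidef) :
    (matrixSqrt W).PosSemidef ∧ matrixSqrt W * matrixSqrt W = W := by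
  open scoped MatrixOrder in
  have h : 0 ≤ W := Matrix.nonneg_iff_posSemidef.mpr hW
  exact ⟨Matrix.nonneg_iff_posSemidef.mp (CFC.sqrt_nonneg W), CFC.sqrt_mul_sqrt_self W h⟩

/-- The matrix of the constraints on a (possibly time-averaged) assignment of sensors `j` to
plants `i`: the entries lie in `[0, 1]`, each sensor is used at most once, and each plant is
observed at most once.  If `busy` holds, every sensor has to be operated (all column sums are `1`);
if `covered` holds, every plant has to be observed (all row sums are `1`).  With `busy` and
`covered` false these are the doubly substochastic constraints. -/
structure IsSubstochastic {N M : ℕ} (busy covered : Prop) (p : Fin N → Fin M → ℝ) : Prop where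
  nonneg : ∀ i j, 0 ≤ p i j
  le_one : ∀ i j, p i j ≤ 1
  col_le : ∀ j, ∑ i, p i j ≤ 1
  row_le : ∀ i, ∑ j, p i j ≤ 1
  col_eq : busy → ∀ j, ∑ i, p i j = 1
  row_eq : covered → ∀ i, ∑ j, p i j = 1

namespace SchedulingProblem

variable {N M : ℕ}

/-- The measurement matrices `C i j`, `j ∈ J`, stacked on top of each other. -/
def stackedC (P : SchedulingProblem N M) (i : Fin N) (J : Finset (Fin M)) :
    Matrix ((j : J) × Fin (P.r i j)) (Fin (P.n i)) ℝ :=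
  Matrix.of fun q b => P.C i q.1 q.2 b

/-- The standing assumptions on the data. -/
structure StandingAssumptions (P : SchedulingProblem N M) : Prop where
  W_posSemidef : ∀ i, (P.W i).PosSemidef
  V_posDef : ∀ i j, (P.V i j).PosDef
  T_posSemidef : ∀ i, (P.T i).PosSemidef
  S0_posDef : ∀ i, (P.S0 i).PosDef
  detectable : ∀ i, ∃ J : Finset (Fin M), IsDetectable (P.A i) (P.stackedC i J)
  controllable : ∀ i, IsControllable (P.A i) (matrixSqrt (P.W i))

/-- The weighted information matrix `∑ j, p i j • (C i j)ᵀ (V i j)⁻¹ (C i j)` of plant `i`. -/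
noncomputable def info (P : SchedulingProblem N M) (p : Fin N → Fin M → ℝ) (i : Fin N) :
    Matrix (Fin (P.n i)) (Fin (P.n i)) ℝ :=
  ∑ j, p i j • ((P.C i j).transpose * (P.V i j)⁻¹ * P.C i j)

/-- An admissible schedule: `π t i j = 1` if sensor `j` observes plant `i` at time `t`, and
`π t i j = 0` otherwise. -/
structure IsSchedule (busy covered : Prop) (π : ℝ → Fin N → Fin M → ℝ) : Prop where
  measurable : Measurable π
  zero_or_one : ∀ t, 0 ≤ t → ∀ i j, π t i j = 0 ∨ π t i j = 1
  constraints : ∀ t, 0 ≤ t → IsSubstochastic busy covered (π t)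

/-- `S t i` is the error covariance of plant `i` at time `t` under the schedule `π`: it is
continuous, and it satisfies, in integrated form (that is, for almost every time), the Riccati
differential equation
`S' = A S + S Aᵀ + W - S (∑ j, π i j • Cᵀ V⁻¹ C) S` with initial value `S0`. -/
structure IsErrorCovariance (P : SchedulingProblem N M) (π : ℝ → Fin N → Fin M → ℝ)
    (S : ℝ → (i : Fin N) → Matrix (Fin (P.n i)) (Fin (P.n i)) ℝ) : Prop where
  continuousOn : ContinuousOn S (Set.Ici 0)
  riccati : ∀ t, 0 ≤ t → ∀ i a b,
    S t i a b = P.S0 i a b + ∫ s in (0 : ℝ)..t,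
      (P.A i * S s i + S s i * (P.A i).transpose + P.W i - S s i * P.info (π s) i * S s i) a b

/-- The average over `[0, τ]` of the weighted error plus the measurement cost. -/
noncomputable def averageCost (P : SchedulingProblem N M) (π : ℝ → Fin N → Fin M → ℝ)
    (S : ℝ → (i : Fin N) → Matrix (Fin (P.n i)) (Fin (P.n i)) ℝ) (τ : ℝ) : ℝ :=
  1 / τ * ∫ t in (0 : ℝ)..τ,
    ∑ i, ((P.T i * S t i).trace + ∑ j, P.κ i j * π t i j)

/-- The long-run average cost, possibly `⊤`. -/
noncomputable def longRunCost (P : SchedulingProblem N M) (π : ℝ → Fin N → Fin M → ℝ)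
    (S : ℝ → (i : Fin N) → Matrix (Fin (P.n i)) (Fin (P.n i)) ℝ) : EReal :=
  Filter.limsup (fun τ : ℝ => ((P.averageCost π S τ : ℝ) : EReal)) Filter.atTop

/-- A matrix for each plant. -/
abbrev Matrices (P : SchedulingProblem N M) : Type :=
  (i : Fin N) → Matrix (Fin (P.n i)) (Fin (P.n i)) ℝ

/-- The feasible points `(Q, p)` of the program with Riccati inequalities
`Q A + Aᵀ Q + Q W Q - ∑ j, p i j • Cᵀ V⁻¹ C ≼ 0`. -/
def riccatiFeasible (P : SchedulingProblem N M) (busy covered : Prop) :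
    Set (P.Matrices × (Fin N → Fin M → ℝ)) :=
  {x | (∀ i, (x.1 i).PosDef) ∧
    (∀ i, (-(x.1 i * P.A i + (P.A i).transpose * x.1 i + x.1 i * P.W i * x.1 i
      - P.info x.2 i)).PosSemidef) ∧
    IsSubstochastic busy covered x.2}

/-- The objective `∑ i, (Tr (T i * (Q i)⁻¹) + ∑ j, κ i j * p i j)`. -/
noncomputable def riccatiObjective (P : SchedulingProblem N M)
    (x : P.Matrices × (Fin N → Fin M → ℝ)) : ℝ :=
  ∑ i, ((P.T i * (x.1 i)⁻¹).trace + ∑ j, P.κ i j * x.2 i j)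

/-- The optimal value (infimum) of the program with Riccati inequalities. -/
noncomputable def riccatiValue (P : SchedulingProblem N M) (busy covered : Prop) : EReal :=
  ⨅ x ∈ P.riccatiFeasible busy covered, ((P.riccatiObjective x : ℝ) : EReal)

/-- The feasible points `(R, Q, p)` of the semidefinite program, with its two linear matrix
inequalities for each plant. -/
def lmiFeasible (P : SchedulingProblem N M) (busy covered : Prop) :
    Set (P.Matrices × P.Matrices × (Fin N → Fin M → ℝ)) :=
  {y | (∀ i, (Matrix.fromBlocks (y.1 i) 1 1 (y.2.1 i)).PosDef) ∧
    (∀ i, (-(Matrix.fromBlocks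
      (y.2.1 i * P.A i + (P.A i).transpose * y.2.1 i - P.info y.2.2 i)
      (y.2.1 i * matrixSqrt (P.W i))
      (matrixSqrt (P.W i) * y.2.1 i)
      (-1))).PosSemidef) ∧
    IsSubstochastic busy covered y.2.2}

/-- The linear objective `∑ i, (Tr (T i * R i) + ∑ j, κ i j * p i j)`. -/
noncomputable def lmiObjective (P : SchedulingProblem N M)
    (y : P.Matrices × P.Matrices × (Fin N → Fin M → ℝ)) : ℝ :=
  ∑ i, ((P.T i * y.1 i).trace + ∑ j, P.κ i j * y.2.2 i j)

/-- The optimal value (infimum) of the semidefinite program. -/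
noncomputable def lmiValue (P : SchedulingProblem N M) (busy covered : Prop) : EReal :=
  ⨅ y ∈ P.lmiFeasible busy covered, ((P.lmiObjective y : ℝ) : EReal)

end SchedulingProblem

section

open Matrix Filter Topology MeasureTheory Set

/-! ### Quadratic forms, tangent inequalities and Schur complements. -/

section MatrixInequalities

variable {n : Type*} [Fintype n]

/-! The lower bound (c) comes from time averages. Along a schedule the inverse covariances satisfy
(Σ⁻¹)' = Γ - (Σ⁻¹A + AᵀΣ⁻¹ + Σ⁻¹WΣ⁻¹), where Γ is linear in π (`IsRiccatiFlow.inv_eq`). Let Q and p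
be the averages of Σ⁻¹ and π over [0, τ]. Convexity of Q ↦ QWQ yields (2) up to a residual Σ₀⁻¹/τ,
because Σ(τ)⁻¹ ≽ 0 can be dropped; convexity of inversion yields that Tr(TQ⁻¹) is at most the
average of Tr(TΣ) (`IsRiccatiFlow.exists_average`). The constraints (1) survive averaging.

The residual is removed by mixing with a Slater point. Detectability provides one: with the uniform
p every sensor contributes, and a small multiple of a Lyapunov matrix of A - LC satisfies (2)
strictly (`IsDetectable.exists_strict_riccati`, `exists_strictlyFeasible`). Given this point weight
θ, its slack absorbs Σ₀⁻¹/τ once τ is large, so Z* ≤ (1 - θ)·(average cost) + θK eventually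
(`eventually_le_averageCost`); then θ is taken small. No compactness of the feasible set is needed.
The Slater point also shows Z* < ∞, while Z* > -∞ because the traces are nonnegative and p is
bounded.

Since π is only measurable, the Riccati equation holds almost everywhere. Symmetry and positivity of
Σ are therefore derived from the integral equation: symmetry by Grönwall for Σ - Σᵀ, positivity by a
Grönwall bound on Tr Σ⁻¹ (`IsRiccatiFlow.posDef`).

Convexity in (a) rests on explicit squares and tangent inequalities, and (b) on Schur complements,
with R = Q⁻¹ + εI and ε → 0 for the optimal value. -/

theorem Matrix.posSemidef_iff_real {M : Matrix n n ℝ} :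
    M.PosSemidef ↔ M.IsHermitian ∧ ∀ x, 0 ≤ x ⬝ᵥ M *ᵥ x := by
  simp [posSemidef_iff_dotProduct_mulVec]

theorem Matrix.PosSemidef.quadratic_nonneg {M : Matrix n n ℝ} (h : M.PosSemidef) (x : n → ℝ) :
    0 ≤ x ⬝ᵥ M *ᵥ x := (posSemidef_iff_real.1 h).2 x

theorem Matrix.posDef_iff_real {M : Matrix n n ℝ} :
    M.PosDef ↔ M.IsHermitian ∧ ∀ x, x ≠ 0 → 0 < x ⬝ᵥ M *ᵥ x := by
  simp [posDef_iff_dotProduct_mulVec]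

theorem dotProduct_self_pos_of_ne_zero {x : n → ℝ} (hx : x ≠ 0) : 0 < x ⬝ᵥ x := by
  simpa using (dotProduct_star_self_pos_iff (v := x)).2 hx

theorem abs_quadratic_le (E : Matrix n n ℝ) (x : n → ℝ) :
    |x ⬝ᵥ E *ᵥ x| ≤ (∑ i, ∑ j, |E i j|) * (x ⬝ᵥ x) := by
  have hx : ∀ i, |x i| ^ 2 ≤ x ⬝ᵥ x := fun i => by
    rw [sq_abs, sq]
    exact Finset.single_le_sum (f := fun i => x i * x i) (fun i _ => mul_self_nonneg _)
      (Finset.mem_univ i)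
  have e : x ⬝ᵥ E *ᵥ x = ∑ i, ∑ j, x i * (E i j * x j) := by
    simp only [dotProduct, mulVec, Finset.mul_sum]
  rw [e, Finset.sum_mul]
  refine (Finset.abs_sum_le_sum_abs _ _).trans (Finset.sum_le_sum fun i _ => ?_)
  rw [Finset.sum_mul]
  refine (Finset.abs_sum_le_sum_abs _ _).trans (Finset.sum_le_sum fun j _ => ?_)
  rw [abs_mul, abs_mul]
  have h1 := hx i
  have h2 := hx j
  have h3 : |x i| * |x j| ≤ x ⬝ᵥ x := by nlinarith [sq_nonneg (|x i| - |x j|)]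
  nlinarith [abs_nonneg (E i j)]

theorem Matrix.IsHermitian.dotProduct_mulVec_comm {M : Matrix n n ℝ} (h : M.IsHermitian)
    (x y : n → ℝ) : x ⬝ᵥ M *ᵥ y = y ⬝ᵥ M *ᵥ x := by
  have h' : Mᵀ = M := by simpa using h.eq
  rw [dotProduct_mulVec, ← mulVec_transpose, h', dotProduct_comm]

variable [DecidableEq n]

omit [Fintype n] in
theorem isHermitian_smul_one (m : ℝ) : (m • (1 : Matrix n n ℝ)).IsHermitian := by
  simp [IsHermitian]

/-- Expand 0 ≤ yᵀMy for y = x - M⁻¹x/c. This turns upper bounds on the inverse into lower bounds on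
M without eigenvalues. -/
theorem Matrix.PosDef.smul_le_quadratic {M : Matrix n n ℝ} (h : M.PosDef) {c : ℝ} (hc0 : 0 < c)
    {x : n → ℝ} (h2 : x ⬝ᵥ M⁻¹ *ᵥ x ≤ c * (x ⬝ᵥ x)) : 1 / c * (x ⬝ᵥ x) ≤ x ⬝ᵥ M *ᵥ x := by
  have hdet : IsUnit M.det := (Matrix.isUnit_iff_isUnit_det _).1 h.isUnit
  have h1 := h.posSemidef.quadratic_nonneg (x - (1 / c) • (M⁻¹ *ᵥ x))
  have h3 : M *ᵥ (M⁻¹ *ᵥ x) = x := by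
    rw [mulVec_mulVec, mul_nonsing_inv _ hdet, one_mulVec]
  have h4 : (M⁻¹ *ᵥ x) ⬝ᵥ M *ᵥ x = x ⬝ᵥ x := by
    rw [h.isHermitian.dotProduct_mulVec_comm, h3]
  have h5 : (M⁻¹ *ᵥ x) ⬝ᵥ x = x ⬝ᵥ M⁻¹ *ᵥ x := dotProduct_comm _ _
  simp only [mulVec_sub, mulVec_smul, h3, dotProduct_sub, sub_dotProduct, smul_dotProduct,
    dotProduct_smul, smul_eq_mul, h4, h5] at h1
  have h6 : 1 / c * (1 / c * (x ⬝ᵥ M⁻¹ *ᵥ x)) ≤ 1 / c * (x ⬝ᵥ x) := by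
    refine mul_le_mul_of_nonneg_left ?_ (by positivity)
    rw [one_div, inv_mul_le_iff₀ hc0]
    exact h2
  linarith

theorem Matrix.PosDef.exists_smul_one_le {M : Matrix n n ℝ} (h : M.PosDef) :
    ∃ m : ℝ, 0 < m ∧ ∀ x, m * (x ⬝ᵥ x) ≤ x ⬝ᵥ M *ᵥ x := by
  set c : ℝ := 1 + ∑ i, ∑ j, |M⁻¹ i j| with hc
  have hc0 : 0 < c := by positivity
  refine ⟨1 / c, by positivity, fun x => h.smul_le_quadratic hc0 ?_⟩
  have := (le_abs_self _).trans (abs_quadratic_le M⁻¹ x)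
  have h0 : 0 ≤ x ⬝ᵥ x := by simpa using dotProduct_star_self_nonneg x
  nlinarith

omit [DecidableEq n] in
theorem Matrix.PosDef.of_smul_one_le {M : Matrix n n ℝ} (hM : M.IsHermitian) {m : ℝ} (hm : 0 < m)
    (h : ∀ x, m * (x ⬝ᵥ x) ≤ x ⬝ᵥ M *ᵥ x) : M.PosDef :=
  posDef_iff_real.2 ⟨hM, fun x hx =>
    (mul_pos hm (dotProduct_self_pos_of_ne_zero hx)).trans_le (h x)⟩

theorem Matrix.PosDef.exists_sub_smul {M E : Matrix n n ℝ} (h : M.PosDef) (hE : E.IsHermitian) :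
    ∃ ε : ℝ, 0 < ε ∧ ∀ δ, 0 ≤ δ → δ ≤ ε → (M - δ • E).PosDef := by
  obtain ⟨m, hm, hM⟩ := h.exists_smul_one_le
  set c : ℝ := 1 + ∑ i, ∑ j, |E i j| with hc
  have hc0 : 0 < c := by positivity
  refine ⟨m / 2 / c, by positivity, fun δ h0 h1 => ?_⟩
  refine PosDef.of_smul_one_le (h.isHermitian.sub ?_) (half_pos hm) fun x => ?_
  · simpa [IsHermitian] using congrArg (δ • ·) hE.eq
  · have h2 := (le_abs_self _).trans (abs_quadratic_le E x)
    have h3 : 0 ≤ x ⬝ᵥ x := by simpa using dotProduct_star_self_nonneg x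
    have h4 : δ * c ≤ m / 2 := by rwa [le_div_iff₀ hc0] at h1
    simp only [sub_mulVec, smul_mulVec, dotProduct_sub, dotProduct_smul, smul_eq_mul]
    have h5 : δ * (x ⬝ᵥ E *ᵥ x) ≤ δ * (c * (x ⬝ᵥ x)) :=
      mul_le_mul_of_nonneg_left (by nlinarith) h0
    nlinarith [hM x]

/-- Writing T = BᴴB, the trace is that of the semidefinite matrix BXBᴴ. -/
theorem Matrix.PosSemidef.trace_mul_nonneg {T X : Matrix n n ℝ} (hT : T.PosSemidef)
    (hX : X.PosSemidef) : 0 ≤ (T * X).trace := by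
  open scoped MatrixOrder in
  obtain ⟨B, rfl⟩ := CStarAlgebra.nonneg_iff_eq_star_mul_self.mp hT.nonneg
  rw [mul_assoc, trace_mul_comm]
  exact (hX.mul_mul_conjTranspose_same B).trace_nonneg

theorem trace_mul_le_of_posSemidef_sub {T X Y : Matrix n n ℝ} (hT : T.PosSemidef)
    (h : (Y - X).PosSemidef) : (T * X).trace ≤ (T * Y).trace := by
  have := hT.trace_mul_nonneg h
  rwa [Matrix.mul_sub, trace_sub, sub_nonneg] at this

/-- By Cauchy–Schwarz |x|²I - xxᵀ is semidefinite; pair it with Q under the trace. -/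
theorem Matrix.PosSemidef.quadratic_le_trace {Q : Matrix n n ℝ} (h : Q.PosSemidef) (x : n → ℝ) :
    x ⬝ᵥ Q *ᵥ x ≤ Q.trace * (x ⬝ᵥ x) := by
  have h1 : ((x ⬝ᵥ x) • 1 - vecMulVec x x).PosSemidef := by
    refine posSemidef_iff_real.2 ⟨(isHermitian_smul_one _).sub ?_, fun y => ?_⟩
    · ext i j; simp [vecMulVec_apply, mul_comm]
    · simp only [sub_mulVec, smul_mulVec, one_mulVec, dotProduct_sub, dotProduct_smul,
        vecMulVec_mulVec, smul_eq_mul, sub_nonneg, op_smul_eq_smul]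
      rw [dotProduct_comm y x]
      have := Finset.sum_mul_sq_le_sq_mul_sq Finset.univ x y
      simpa [dotProduct, sq] using this
  have h2 := h.trace_mul_nonneg h1
  rw [Matrix.mul_sub, trace_sub, mul_smul_comm, mul_one, trace_smul, mul_vecMulVec,
    trace_vecMulVec, sub_nonneg, smul_eq_mul, mul_comm, dotProduct_comm] at h2
  exact h2

/-- The difference is the square (Q⁻¹ - X)Q(Q⁻¹ - X). For invertible X the subtracted term is the
tangent of inversion at X⁻¹, and it is affine in Q, so it can be averaged. -/
theorem posSemidef_inv_sub_tangent {Q X : Matrix n n ℝ} (hQ : Q.PosDef) (hX : X.IsHermitian) :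
    (Q⁻¹ - (X + X - X * Q * X)).PosSemidef := by
  have hdet : IsUnit Q.det := (Matrix.isUnit_iff_isUnit_det _).1 hQ.isUnit
  have h := hQ.posSemidef.conjTranspose_mul_mul_same (Q⁻¹ - X)
  rw [(hQ.inv.isHermitian.sub hX).eq] at h
  have e : (Q⁻¹ - X) * Q * (Q⁻¹ - X) = Q⁻¹ - (X + X - X * Q * X) := by
    rw [sub_mul, nonsing_inv_mul _ hdet, mul_sub, sub_mul, sub_mul, mul_assoc X Q Q⁻¹,
      mul_nonsing_inv _ hdet]
    noncomm_ring
  rwa [e] at h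

theorem posSemidef_conj_sub_tangent {W Q X : Matrix n n ℝ} (hW : W.PosSemidef)
    (hQ : Q.IsHermitian) (hX : X.IsHermitian) :
    (Q * W * Q - (Q * W * X + X * W * Q - X * W * X)).PosSemidef := by
  have h := hW.conjTranspose_mul_mul_same (Q - X)
  rw [(hQ.sub hX).eq] at h
  have e : (Q - X) * W * (Q - X) = Q * W * Q - (Q * W * X + X * W * Q - X * W * X) := by
    noncomm_ring
  rwa [e] at h

/-- The semidefinite Schur criterion becomes strict through det = det Q · det(R - Q⁻¹), since a
semidefinite matrix is definite exactly when its determinant is nonzero. -/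
theorem posDef_fromBlocks_one_iff {R Q : Matrix n n ℝ} :
    (fromBlocks R 1 1 Q).PosDef ↔ Q.PosDef ∧ (R - Q⁻¹).PosDef := by
  have key : ∀ hQ : Q.PosDef, (fromBlocks R 1 1 Q).PosDef ↔ (R - Q⁻¹).PosDef := fun hQ => by
    have := hQ.isUnit.invertible
    have h1 := hQ.fromBlocks₂₂ R 1
    rw [conjTranspose_one, mul_one, one_mul] at h1
    have h2 : (fromBlocks R 1 1 Q).det = Q.det * (R - Q⁻¹).det := by
      rw [det_fromBlocks₂₂, mul_one, one_mul, invOf_eq_nonsing_inv]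
    have h3 := hQ.det_pos.ne'
    constructor
    · intro h
      refine (h1.1 h.posSemidef).posDef_iff_det_ne_zero.2 fun h0 => ?_
      exact h.det_pos.ne' (by rw [h2, h0, mul_zero])
    · intro h
      exact (h1.2 h.posSemidef).posDef_iff_det_ne_zero.2
        (by rw [h2]; exact mul_ne_zero h3 h.det_pos.ne')
  constructor
  · intro h
    have hQ : Q.PosDef := by
      have := h.submatrix (e := Sum.inr) Sum.inr_injective
      exact this
    exact ⟨hQ, (key hQ).1 h⟩
  · exact fun h => (key h.1).2 h.2

end MatrixInequalities

/-! ### Lyapunov matrices and strict Riccati inequalities. -/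

section Lyapunov

open scoped Matrix.Norms.Operator in
-- Gelfand's formula: ‖Gᵏ‖ is eventually at most rᵏ for some r < 1 above the spectral radius.
theorem tendsto_pow_zero_of_spectrum {n : Type*} [Fintype n] [DecidableEq n] [Nonempty n]
    (G : Matrix n n ℂ) (h : ∀ z ∈ spectrum ℂ G, ‖z‖ < 1) :
    Tendsto (fun k => G ^ k) atTop (𝓝 0) := by
  have hs : spectralRadius ℂ G < (1 : NNReal) :=
    spectrum.spectralRadius_lt_of_forall_lt G fun z hz => by
      rw [← NNReal.coe_lt_coe]; simpa using h z hz
  obtain ⟨r, hr0, hr1⟩ := ENNReal.lt_iff_exists_nnreal_btwn.1 hs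
  have hr1' : r < 1 := by exact_mod_cast hr1
  have h1 := (spectrum.pow_nnnorm_pow_one_div_tendsto_nhds_spectralRadius G).eventually_lt_const hr0
  refine tendsto_zero_iff_norm_tendsto_zero.2 ?_
  refine squeeze_zero' (Eventually.of_forall fun _ => norm_nonneg _) ?_
    (tendsto_pow_atTop_nhds_zero_of_lt_one r.2 (by exact_mod_cast hr1'))
  filter_upwards [h1, eventually_gt_atTop 0] with k hk hk0
  have hk0' : (0 : ℝ) < k := by exact_mod_cast hk0
  have h2 : (‖G ^ k‖₊ : ENNReal) ≤ (r : ENNReal) ^ k := by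
    have := ENNReal.rpow_le_rpow hk.le hk0'.le
    rw [← ENNReal.rpow_mul, one_div, inv_mul_cancel₀ hk0'.ne', ENNReal.rpow_one,
      ENNReal.rpow_natCast] at this
    exact this
  exact_mod_cast h2

/-- An explicit Euler step is a discrete contraction: |1 + hz|² = 1 + h(2 Re z + h|z|²) < 1 for
small h > 0, uniformly over the finitely many eigenvalues z. -/
theorem IsHurwitz.exists_pow_small {n : Type*} [Fintype n] [DecidableEq n] [Nonempty n]
    {F : Matrix n n ℝ} (hF : IsHurwitz F) :
    ∃ h : ℝ, 0 < h ∧ Tendsto (fun k => (1 + h • F) ^ k) atTop (𝓝 0) := by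
  set FC : Matrix n n ℂ := F.map (fun x : ℝ => (x : ℂ)) with hFC
  have hfin : (spectrum ℂ FC).Finite := Matrix.finite_spectrum FC
  have h1 : ∀ᶠ h : ℝ in 𝓝[>] 0, ∀ z ∈ spectrum ℂ FC, ‖1 + (h : ℂ) * z‖ < 1 := by
    rw [hfin.eventually_all]
    intro z hz
    have hz' := hF z hz
    have h2 : Tendsto (fun h : ℝ => 2 * z.re + h * Complex.normSq z) (𝓝[>] 0)
        (𝓝 (2 * z.re + 0 * Complex.normSq z)) :=
      tendsto_nhdsWithin_of_tendsto_nhds (Continuous.tendsto (by fun_prop) _)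
    have h3 := h2.eventually_lt_const (u := 0) (by linarith)
    filter_upwards [h3, self_mem_nhdsWithin] with h h4 h5
    have h5' : 0 < h := h5
    rw [← sq_lt_one_iff₀ (norm_nonneg _), ← Complex.normSq_eq_norm_sq]
    rw [Complex.normSq_apply] at h4 ⊢
    simp
    nlinarith
  obtain ⟨h, h2, h3⟩ := (h1.and self_mem_nhdsWithin).exists
  have h3' : 0 < h := h3
  refine ⟨h, h3', ?_⟩
  have h4 := tendsto_pow_zero_of_spectrum (1 + (h : ℂ) • FC) fun z hz => by
    have h5 : (z - 1) / h ∈ spectrum ℂ FC := by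
      have h6 : (h : ℂ) ≠ 0 := by exact_mod_cast h3'.ne'
      rw [spectrum.mem_iff] at hz ⊢
      contrapose! hz
      have e : algebraMap ℂ (Matrix n n ℂ) z - (1 + (h : ℂ) • FC) =
          (Units.mk0 (h : ℂ) h6) • (algebraMap ℂ (Matrix n n ℂ) ((z - 1) / h) - FC) := by
        rw [Units.smul_mk0, smul_sub, Algebra.algebraMap_eq_smul_one,
          Algebra.algebraMap_eq_smul_one, smul_smul, mul_div_cancel₀ _ h6, sub_smul, one_smul]
        abel
      rw [e]
      exact hz.smul _
    have h6 := h2 _ h5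
    have h7 : (h : ℂ) ≠ 0 := by exact_mod_cast h3'.ne'
    rwa [mul_div_cancel₀ _ h7, add_sub_cancel] at h6
  have e : ∀ k : ℕ, (1 + (h : ℂ) • FC) ^ k = ((1 + h • F) ^ k).map (fun x : ℝ => (x : ℂ)) := by
    intro k
    have e1 : (1 + (h : ℂ) • FC) = (Complex.ofRealHom.mapMatrix (1 + h • F)) := by
      ext i j
      by_cases hij : i = j <;> simp [hFC, hij]
    rw [e1, ← map_pow]
    rfl
  simp only [e] at h4
  refine tendsto_pi_nhds.2 fun i => tendsto_pi_nhds.2 fun j => ?_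
  have h6 := (Complex.continuous_re.tendsto _).comp (tendsto_pi_nhds.1 (tendsto_pi_nhds.1 h4 i) j)
  simpa [Function.comp_def] using h6

theorem lyapunov_telescope {n : Type*} [Fintype n] [DecidableEq n] (G : Matrix n n ℝ) (k : ℕ) :
    Gᵀ * (∑ j ∈ Finset.range k, (G ^ j)ᵀ * G ^ j) * G =
      ∑ j ∈ Finset.range k, (G ^ j)ᵀ * G ^ j + (G ^ k)ᵀ * G ^ k - 1 := by
  have h : ∀ j : ℕ, Gᵀ * ((G ^ j)ᵀ * G ^ j) * G = (G ^ (j + 1))ᵀ * G ^ (j + 1) := fun j => by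
    rw [pow_succ, transpose_mul]; simp only [mul_assoc]
  rw [Finset.mul_sum, Finset.sum_mul]
  simp only [h]
  have := Finset.sum_range_succ' (fun j => (G ^ j)ᵀ * G ^ j) k
  rw [Finset.sum_range_succ] at this
  simp only [pow_zero, transpose_one, mul_one] at this
  rw [this]; abel

/-- A finite sum X = ∑_{j<k} (Gʲ)ᵀGʲ with G = 1 + hF suffices, once k is so large that (Gᵏ)ᵀGᵏ ≺ I;
neither the matrix exponential nor an infinite series is needed. -/
theorem IsHurwitz.exists_lyapunov {n : Type*} [Fintype n] [DecidableEq n]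
    {F : Matrix n n ℝ} (hF : IsHurwitz F) :
    ∃ X : Matrix n n ℝ, X.PosDef ∧ (-(X * F + Fᵀ * X)).PosDef := by
  rcases isEmpty_or_nonempty n with hn | hn
  · exact ⟨1, PosDef.one, by rw [Subsingleton.elim (-(1 * F + Fᵀ * 1)) 1]; exact PosDef.one⟩
  obtain ⟨h, hh, hlim⟩ := hF.exists_pow_small
  set G := 1 + h • F with hG
  have hev : ∀ᶠ k in atTop, (1 - (G ^ k)ᵀ * G ^ k).PosDef := by
    have h1 : Tendsto (fun k : ℕ => ∑ i, ∑ j, |((G ^ k)ᵀ * G ^ k : Matrix n n ℝ) i j|)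
        atTop (𝓝 (0 : ℝ)) := by
      have h2 : Continuous fun X : Matrix n n ℝ => ∑ i, ∑ j, |(Xᵀ * X) i j| := by
        refine continuous_finsetSum _ fun i _ => continuous_finsetSum _ fun j _ => ?_
        exact ((continuous_id.matrix_transpose.matrix_mul continuous_id).matrix_elem i j).abs
      have h3 := (h2.tendsto 0).comp hlim
      simp only [mul_zero, Matrix.zero_apply, abs_zero, Finset.sum_const_zero] at h3
      exact h3
    filter_upwards [h1.eventually_lt_const (u := 1 / 2) (by norm_num)] with k hk
    refine PosDef.of_smul_one_le (m := 1 / 2) ?_ (by norm_num) fun x => ?_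
    · have := (isHermitian_one (n := n) (α := ℝ)).sub (isHermitian_conjTranspose_mul_self (G ^ k))
      simpa using this
    · have h3 := (le_abs_self _).trans (abs_quadratic_le ((G ^ k)ᵀ * G ^ k) x)
      have h4 : 0 ≤ x ⬝ᵥ x := by simpa using dotProduct_star_self_nonneg x
      rw [sub_mulVec, dotProduct_sub, one_mulVec]
      nlinarith
  obtain ⟨k, hk, hk0⟩ := (hev.and (eventually_gt_atTop 0)).exists
  set X := ∑ j ∈ Finset.range k, (G ^ j)ᵀ * G ^ j with hX
  have hXpd : X.PosDef := by
    obtain ⟨l, rfl⟩ := Nat.exists_eq_add_of_lt hk0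
    rw [hX, zero_add, Finset.sum_range_succ']
    simp only [pow_zero, transpose_one, mul_one]
    refine PosDef.posSemidef_add (posSemidef_sum _ fun j _ => ?_) PosDef.one
    simpa using posSemidef_conjTranspose_mul_self (G ^ (j + 1))
  refine ⟨X, hXpd, ?_⟩
  have h1 := lyapunov_telescope G k
  rw [← hX] at h1
  -- Expanding GᵀXG in the telescoped identity: the second-order Euler term FᵀXF has the favourable
  -- sign.
  have h2 : h • (-(X * F + Fᵀ * X)) = (1 - (G ^ k)ᵀ * G ^ k) + (h ^ 2) • (Fᵀ * X * F) := by
    have h3 : Gᵀ * X * G = X + h • (X * F + Fᵀ * X) + (h ^ 2) • (Fᵀ * X * F) := by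
      simp only [hG, transpose_add, transpose_smul, transpose_one, add_mul, mul_add, one_mul,
        mul_one, smul_mul_assoc, mul_smul_comm, sq]
      module
    rw [h3] at h1
    have h4 : (G ^ k)ᵀ * G ^ k = h • (X * F + Fᵀ * X) + (h ^ 2) • (Fᵀ * X * F) + 1 := by
      rw [eq_sub_iff_add_eq] at h1
      rw [← add_right_inj X, ← h1]; abel
    rw [h4]; module
  have h3 : (h • (-(X * F + Fᵀ * X))).PosDef := by
    rw [h2]
    refine hk.add_posSemidef (PosSemidef.smul ?_ (by positivity))
    simpa using hXpd.posSemidef.conjTranspose_mul_mul_same F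
  have h4 := h3.smul (inv_pos.2 hh)
  rwa [smul_smul, inv_mul_cancel₀ hh.ne', one_smul] at h4

end Lyapunov

/-- Take Q = εX with X a Lyapunov matrix of A - LC. Completing the square in the cross terms XLC +
CᵀLᵀX against c CᵀC costs only ε²/c · XLLᵀX, which like ε²XWX is dominated by εY for small ε, where
Y ≻ 0 is the Lyapunov slack. -/
theorem IsDetectable.exists_strict_riccati {n r : Type*} [Fintype n] [DecidableEq n] [Fintype r]
    [DecidableEq r] {A W Γ : Matrix n n ℝ} {C : Matrix r n ℝ} (h : IsDetectable A C)
    (hW : W.PosSemidef) {c : ℝ} (hc : 0 < c) (hΓ : (Γ - c • (Cᵀ * C)).PosSemidef) :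
    ∃ Q : Matrix n n ℝ, Q.PosDef ∧ (-(Q * A + Aᵀ * Q + Q * W * Q - Γ)).PosDef := by
  obtain ⟨L, hL⟩ := h
  obtain ⟨X, hX, hY⟩ := hL.exists_lyapunov
  have hXs : Xᵀ = X := by simpa using hX.isHermitian.eq
  have hWs : Wᵀ = W := by simpa using hW.isHermitian.eq
  set Y := -(X * (A - L * C) + (A - L * C)ᵀ * X) with hYdef
  set E := X * W * X + c⁻¹ • (X * L * Lᵀ * X) with hE
  have hEs : E.IsHermitian := by
    rw [IsHermitian, conjTranspose_eq_transpose_of_trivial, hE]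
    simp [hXs, hWs, mul_assoc, Matrix.mul_assoc]
  obtain ⟨ε, hε, hYE⟩ := hY.exists_sub_smul hEs
  refine ⟨ε • X, hX.smul hε, ?_⟩
  have h1 : (c • ((C - (ε / c) • (Lᵀ * X))ᵀ * (C - (ε / c) • (Lᵀ * X)))).PosSemidef := by
    refine PosSemidef.smul ?_ hc.le
    simpa using posSemidef_conjTranspose_mul_self (C - (ε / c) • (Lᵀ * X))
  have h2 := ((hYE ε hε.le le_rfl).smul hε).add_posSemidef (h1.add hΓ)
  convert h2 using 1
  simp only [hYdef, hE, transpose_sub, transpose_smul, transpose_mul, transpose_transpose, hXs,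
    sub_mul, mul_sub, smul_mul_assoc, mul_smul_comm, smul_smul, smul_sub, smul_add, smul_neg,
    Matrix.smul_mul, Matrix.mul_smul, Matrix.sub_mul, Matrix.mul_sub, ← Matrix.mul_assoc]
  match_scalars <;> field_simp <;> ring

/-! ### Grönwall's inequality and scalar integrability. -/

section ScalarIntegrals

theorem le_exp_of_le_add_mul_integral_of_continuous {u : ℝ → ℝ} {a k T : ℝ} (hk : 0 ≤ k)
    (hu : Continuous u) (h : ∀ t ∈ Icc 0 T, u t ≤ a + k * ∫ s in (0 : ℝ)..t, u s) :
    ∀ t ∈ Icc 0 T, u t ≤ a * Real.exp (k * t) := by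
  intro t ht
  have hd : ∀ t, HasDerivAt (fun t => ∫ s in (0 : ℝ)..t, u s) (u t) t := fun t =>
    intervalIntegral.integral_hasDerivAt_right (hu.intervalIntegrable _ _)
      hu.stronglyMeasurable.stronglyMeasurableAtFilter hu.continuousAt
  have h1 := le_gronwallBound_of_liminf_deriv_right_le (f := fun t => ∫ s in (0 : ℝ)..t, u s)
    (f' := u) (δ := 0) (K := k) (ε := a) (a := 0) (b := T)
    (fun x _ => (hd x).continuousAt.continuousWithinAt)
    (fun x _ r hr => by
      simpa [slope_def_field, div_eq_inv_mul] using
        ((hd x).hasDerivWithinAt (s := Ici x)).liminf_right_slope_le hr)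
    (by simp) (fun x hx => by linarith [h x ⟨hx.1, hx.2.le⟩]) t ht
  refine (h t ht).trans ?_
  have h2 : a + k * gronwallBound 0 k a t = a * Real.exp (k * t) := by
    rcases hk.eq_or_lt with rfl | hk'
    · simp
    · rw [gronwallBound_of_K_ne_0 hk'.ne']
      field_simp
      ring
  rw [← h2]
  rw [sub_zero] at h1
  gcongr

/-- Grönwall's inequality in integrated form. -/
theorem le_exp_of_le_add_mul_integral {u : ℝ → ℝ} {a k T : ℝ} (hk : 0 ≤ k)
    (hu : ContinuousOn u (Icc 0 T)) (h : ∀ t ∈ Icc 0 T, u t ≤ a + k * ∫ s in (0 : ℝ)..t, u s) :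
    ∀ t ∈ Icc 0 T, u t ≤ a * Real.exp (k * t) := by
  intro t ht
  have hT : 0 ≤ T := ht.1.trans ht.2
  have he : ∀ s ∈ Icc 0 T, IccExtend hT (fun x : Icc 0 T => u x) s = u s := fun s hs =>
    IccExtend_of_mem hT _ hs
  have := le_exp_of_le_add_mul_integral_of_continuous (u := IccExtend hT (fun x : Icc 0 T => u x))
    (a := a) (T := T) hk (continuousOn_iff_continuous_domRestrict.1 hu).Icc_extend'
    (fun s hs => by
      rw [he s hs]
      refine (h s hs).trans_eq ?_
      congr 2
      refine intervalIntegral.integral_congr fun x hx => ?_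
      rw [uIcc_of_le hs.1] at hx
      exact (he x ⟨hx.1, hx.2.trans hs.2⟩).symm) t ht
  rwa [he t ht] at this

theorem Measurable.intervalIntegrable_of_abs_le {f : ℝ → ℝ} (hf : Measurable f) {c : ℝ}
    (h : ∀ t, |f t| ≤ c) (a b : ℝ) : IntervalIntegrable f volume a b :=
  (intervalIntegrable_const (c := c)).mono_fun' hf.aestronglyMeasurable
    (Eventually.of_forall fun t => by simpa using h t)

end ScalarIntegrals

/-! ### Indefinite integrals in Banach algebras. -/

section BanachIntegrals

/-- The fundamental theorem under an almost everywhere derivative: f minus the integral of f' is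
absolutely continuous with zero derivative almost everywhere, hence constant. -/
theorem LipschitzOnWith.sub_eq_integral_of_ae_hasDerivAt {E : Type*} [NormedAddCommGroup E]
    [NormedSpace ℝ E] [CompleteSpace E] {f f' : ℝ → E} {a b C : ℝ} {K : NNReal}
    (hf : LipschitzOnWith K f (uIcc a b)) (hf' : IntervalIntegrable f' volume a b)
    (hb : ∀ t ∈ uIcc a b, ‖f' t‖ ≤ C) (hd : ∀ᵐ t, t ∈ uIcc a b → HasDerivAt f (f' t) t) :
    f b - f a = ∫ t in a..b, f' t := by
  have hC : 0 ≤ C := (norm_nonneg _).trans (hb a left_mem_uIcc)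
  have hint : ∀ x ∈ uIcc a b, IntervalIntegrable f' volume a x := fun x hx =>
    hf'.mono_set (uIcc_subset_uIcc left_mem_uIcc hx)
  have hL : LipschitzOnWith C.toNNReal (fun x => ∫ t in a..x, f' t) (uIcc a b) := by
    refine LipschitzOnWith.of_dist_le_mul fun x hx y hy => ?_
    rw [dist_eq_norm, intervalIntegral.integral_interval_sub_left (hint x hx) (hint y hy),
      Real.coe_toNNReal _ hC, Real.dist_eq]
    refine intervalIntegral.norm_integral_le_of_norm_le_const fun t ht => hb t ?_
    exact uIcc_subset_uIcc hy hx (uIoc_subset_uIcc ht)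
  have hac := hf.absolutelyContinuousOnInterval.sub hL.absolutelyContinuousOnInterval
  obtain ⟨c, hc⟩ := hac.const_of_ae_hasDerivAt_zero (by
    filter_upwards [hd, hf'.ae_hasDerivAt_integral] with t h1 h2 ht
    simpa using (h1 ht).sub (h2 ht a left_mem_uIcc))
  have h1 := hc a left_mem_uIcc
  have h2 := hc b right_mem_uIcc
  simp only [Pi.sub_apply, intervalIntegral.integral_same, sub_zero] at h1 h2
  rw [h1, ← h2]; abel

variable {R : Type*} [NormedRing R] [NormedAlgebra ℝ R] [CompleteSpace R]

omit [NormedAlgebra ℝ R] [CompleteSpace R] in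
theorem ringInverse_sub_ringInverse {x y : R} (hx : IsUnit x) (hy : IsUnit y) :
    Ring.inverse x - Ring.inverse y = -(Ring.inverse x * (x - y) * Ring.inverse y) := by
  rw [mul_sub, Ring.inverse_mul_cancel _ hx, sub_mul, one_mul, mul_assoc,
    Ring.mul_inverse_cancel _ hy, mul_one]
  abel

/-- The inverse of an indefinite integral is an indefinite integral. -/
theorem ringInverse_sub_eq_integral {S G : ℝ → R} {S0 : R} {T C : ℝ} (hT : 0 ≤ T)
    (hG : IntervalIntegrable G volume 0 T) (hC : ∀ t ∈ Icc 0 T, ‖G t‖ ≤ C)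
    (hS : ∀ t ∈ Icc 0 T, S t = S0 + ∫ s in (0 : ℝ)..t, G s)
    (hu : ∀ t ∈ Icc 0 T, IsUnit (S t)) :
    ContinuousOn (fun t => Ring.inverse (S t)) (Icc 0 T) ∧
    Ring.inverse (S T) - Ring.inverse (S 0) =
      ∫ t in (0 : ℝ)..T, -(Ring.inverse (S t) * G t * Ring.inverse (S t)) := by
  have hC0 : 0 ≤ C := (norm_nonneg _).trans (hC 0 ⟨le_rfl, hT⟩)
  have hint : ∀ x ∈ Icc 0 T, IntervalIntegrable G volume 0 x := fun x hx =>
    hG.mono_set (uIcc_subset_uIcc left_mem_uIcc (by rwa [uIcc_of_le hT]))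
  have hSL : ∀ x ∈ Icc 0 T, ∀ y ∈ Icc 0 T, ‖S x - S y‖ ≤ C * |x - y| := fun x hx y hy => by
    rw [hS x hx, hS y hy, add_sub_add_left_eq_sub,
      intervalIntegral.integral_interval_sub_left (hint x hx) (hint y hy)]
    refine intervalIntegral.norm_integral_le_of_norm_le_const fun t ht => hC t ?_
    have := uIcc_subset_uIcc (a₂ := 0) (b₂ := T) (by rwa [uIcc_of_le hT])
      (by rwa [uIcc_of_le hT]) (uIoc_subset_uIcc ht)
    rwa [uIcc_of_le hT] at this
  have hSc : ContinuousOn S (Icc 0 T) := by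
    refine (LipschitzOnWith.of_dist_le_mul (K := C.toNNReal) fun x hx y hy => ?_).continuousOn
    rw [dist_eq_norm, Real.coe_toNNReal _ hC0, Real.dist_eq]
    exact hSL x hx y hy
  have hQc : ContinuousOn (fun t => Ring.inverse (S t)) (Icc 0 T) := fun t ht => by
    obtain ⟨u, hu'⟩ := hu t ht
    have := NormedRing.inverse_continuousAt u
    rw [hu'] at this
    exact this.comp_continuousWithinAt (hSc t ht)
  refine ⟨hQc, ?_⟩
  obtain ⟨B, hB⟩ := isCompact_Icc.exists_bound_of_continuousOn hQc
  have hB0 : 0 ≤ B := (norm_nonneg _).trans (hB 0 ⟨le_rfl, hT⟩)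
  have hQc' := hQc
  rw [← uIcc_of_le hT] at hQc'
  refine LipschitzOnWith.sub_eq_integral_of_ae_hasDerivAt (E := R)
    (f := fun t => Ring.inverse (S t)) (K := (B * C * B).toNNReal)
    (C := B * C * B) ?_ ?_ ?_ ?_
  · rw [uIcc_of_le hT]
    refine LipschitzOnWith.of_dist_le_mul fun x hx y hy => ?_
    rw [dist_eq_norm, ringInverse_sub_ringInverse (hu x hx) (hu y hy), norm_neg, Real.dist_eq,
      Real.coe_toNNReal _ (by positivity)]
    calc _ ≤ ‖Ring.inverse (S x)‖ * ‖S x - S y‖ * ‖Ring.inverse (S y)‖ := norm_mul₃_le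
      _ ≤ B * (C * |x - y|) * B := by
        gcongr
        · exact hB x hx
        · exact hSL x hx y hy
        · exact hB y hy
      _ = _ := by ring
  · exact ((hG.continuousOn_mul hQc').mul_continuousOn hQc').neg
  · rw [uIcc_of_le hT]
    intro t ht
    rw [norm_neg]
    calc _ ≤ ‖Ring.inverse (S t)‖ * ‖G t‖ * ‖Ring.inverse (S t)‖ := norm_mul₃_le
      _ ≤ B * C * B := by
        gcongr
        · exact hB t ht
        · exact hC t ht
        · exact hB t ht
  · rw [uIcc_of_le hT]
    -- The endpoints are discarded: the integral equation is known only on [0, T], so two-sided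
    -- derivatives are available only in the interior.
    have h1 : ∀ᵐ x : ℝ, x ≠ 0 := by simp [ae_iff, measure_singleton]
    have h2 : ∀ᵐ x : ℝ, x ≠ T := by simp [ae_iff, measure_singleton]
    filter_upwards [hG.ae_hasDerivAt_integral, h1, h2] with t h3 h4 h5 ht
    have hS' : HasDerivAt S (G t) t := by
      have h6 := (h3 (by rwa [uIcc_of_le hT]) 0 left_mem_uIcc).const_add S0
      refine h6.congr_of_eventuallyEq ?_
      filter_upwards [Ioo_mem_nhds (lt_of_le_of_ne ht.1 h4.symm) (lt_of_le_of_ne ht.2 h5)] with s hs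
      exact hS s ⟨hs.1.le, hs.2.le⟩
    obtain ⟨u, hu'⟩ := hu t ht
    have h7 := hasFDerivAt_ringInverse (𝕜 := ℝ) u
    rw [hu'] at h7
    have h8 := h7.comp_hasDerivAt t hS'
    rw [← hu', Ring.inverse_unit]
    simp only [_root_.neg_apply, ContinuousLinearMap.mulLeftRight_apply] at h8
    exact h8

end BanachIntegrals

/-! ### Entrywise integrals of matrix-valued functions. -/

section MatrixIntegrals

set_option linter.unusedSectionVars false

variable {m n k : Type*} [Fintype m] [Fintype n] [Fintype k]

/-- All entries of a matrix-valued function are integrable on an interval. -/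
def EntryIntegrable (X : ℝ → Matrix m n ℝ) (a b : ℝ) : Prop :=
  ∀ i j, IntervalIntegrable (fun t => X t i j) volume a b

/-- The entrywise integral of a matrix-valued function. -/
noncomputable def entryIntegral (X : ℝ → Matrix m n ℝ) (a b : ℝ) : Matrix m n ℝ :=
  Matrix.of fun i j => ∫ t in a..b, X t i j

/-- Expansion in matrix units reduces integrals of linear images to scalar integrals of the entries,
without choosing a norm on matrices. -/
theorem linearMap_apply_eq_sum_entries {E : Type*} [AddCommGroup E] [Module ℝ E]
    (φ : Matrix m n ℝ →ₗ[ℝ] E) (X : Matrix m n ℝ) :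
    open Classical in φ X = ∑ i, ∑ j, X i j • φ (Matrix.single i j 1) := by
  classical
  conv_lhs => rw [matrix_eq_sum_single X]
  simp only [map_sum]
  refine Finset.sum_congr rfl fun i _ => Finset.sum_congr rfl fun j _ => ?_
  rw [← map_smul, smul_single, smul_eq_mul, mul_one]

variable {X Y : ℝ → Matrix m n ℝ} {a b : ℝ}

theorem EntryIntegrable.linearMap {E : Type*} [NormedAddCommGroup E] [NormedSpace ℝ E]
    (hX : EntryIntegrable X a b) (φ : Matrix m n ℝ →ₗ[ℝ] E) :
    IntervalIntegrable (fun t => φ (X t)) volume a b := by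
  have e := fun t => linearMap_apply_eq_sum_entries φ (X t)
  simp only [e]
  have := IntervalIntegrable.sum (μ := volume) (a := a) (b := b) Finset.univ
    (f := fun i t => ∑ j, X t i j • φ (by classical exact Matrix.single i j 1)) fun i _ => by
      have := IntervalIntegrable.sum (μ := volume) (a := a) (b := b) Finset.univ
        (f := fun j t => X t i j • φ (by classical exact Matrix.single i j 1)) fun j _ =>
          (hX i j).smul_continuousOn continuousOn_const
      simpa [Finset.sum_fn] using this
  simpa [Finset.sum_fn] using this

theorem integral_linearMap {E : Type*} [NormedAddCommGroup E] [NormedSpace ℝ E]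
    [CompleteSpace E]
    (hX : EntryIntegrable X a b) (φ : Matrix m n ℝ →ₗ[ℝ] E) :
    ∫ t in a..b, φ (X t) = φ (entryIntegral X a b) := by
  have e := fun t => linearMap_apply_eq_sum_entries φ (X t)
  rw [linearMap_apply_eq_sum_entries φ (entryIntegral X a b)]
  simp only [e]
  have h1 : ∀ i j, IntervalIntegrable
      (fun t => X t i j • φ (by classical exact Matrix.single i j 1)) volume a b := fun i j =>
    (hX i j).smul_continuousOn continuousOn_const
  rw [intervalIntegral.integral_finsetSum]
  · refine Finset.sum_congr rfl fun i _ => ?_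
    rw [intervalIntegral.integral_finsetSum fun j _ => h1 i j]
    refine Finset.sum_congr rfl fun j _ => ?_
    rw [intervalIntegral.integral_smul_const]
    rfl
  · intro i _
    have := IntervalIntegrable.sum Finset.univ fun j _ => h1 i j
    simpa [Finset.sum_fn] using this

theorem ContinuousOn.entryIntegrable (h : ContinuousOn X (uIcc a b)) : EntryIntegrable X a b :=
  fun i j => ContinuousOn.intervalIntegrable
    (((continuous_id.matrix_elem i j).comp_continuousOn h :))

theorem EntryIntegrable.add (hX : EntryIntegrable X a b) (hY : EntryIntegrable Y a b) :
    EntryIntegrable (fun t => X t + Y t) a b := fun i j => (hX i j).add (hY i j)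

theorem EntryIntegrable.sub (hX : EntryIntegrable X a b) (hY : EntryIntegrable Y a b) :
    EntryIntegrable (fun t => X t - Y t) a b := fun i j => (hX i j).sub (hY i j)

theorem EntryIntegrable.neg (hX : EntryIntegrable X a b) :
    EntryIntegrable (fun t => -X t) a b := fun i j => (hX i j).neg

theorem EntryIntegrable.map {k l : Type*} [Fintype k] [Fintype l] (hX : EntryIntegrable X a b)
    (φ : Matrix m n ℝ →ₗ[ℝ] Matrix k l ℝ) : EntryIntegrable (fun t => φ (X t)) a b :=
  fun i j => hX.linearMap (Matrix.entryLinearMap ℝ ℝ i j ∘ₗ φ)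

theorem entryIntegral_map {k l : Type*} [Fintype k] [Fintype l] (hX : EntryIntegrable X a b)
    (φ : Matrix m n ℝ →ₗ[ℝ] Matrix k l ℝ) :
    entryIntegral (fun t => φ (X t)) a b = φ (entryIntegral X a b) := by
  ext i j
  exact integral_linearMap hX (Matrix.entryLinearMap ℝ ℝ i j ∘ₗ φ)

theorem entryIntegral_add (hX : EntryIntegrable X a b) (hY : EntryIntegrable Y a b) :
    entryIntegral (fun t => X t + Y t) a b = entryIntegral X a b + entryIntegral Y a b := by
  ext i j
  exact intervalIntegral.integral_add (hX i j) (hY i j)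

theorem entryIntegral_sub (hX : EntryIntegrable X a b) (hY : EntryIntegrable Y a b) :
    entryIntegral (fun t => X t - Y t) a b = entryIntegral X a b - entryIntegral Y a b := by
  ext i j
  exact intervalIntegral.integral_sub (hX i j) (hY i j)

theorem EntryIntegrable.mul_continuousOn {Z : ℝ → Matrix n k ℝ} (hX : EntryIntegrable X a b)
    (hZ : ContinuousOn Z (uIcc a b)) : EntryIntegrable (fun t => X t * Z t) a b := fun i j => by
  have := IntervalIntegrable.sum Finset.univ fun l (_ : l ∈ Finset.univ) =>
    (hX i l).mul_continuousOn (((continuous_id.matrix_elem l j).comp_continuousOn hZ :))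
  simpa [Finset.sum_fn, mul_apply] using this

theorem EntryIntegrable.continuousOn_mul {Z : ℝ → Matrix k m ℝ} (hX : EntryIntegrable X a b)
    (hZ : ContinuousOn Z (uIcc a b)) : EntryIntegrable (fun t => Z t * X t) a b := fun i j => by
  have := IntervalIntegrable.sum Finset.univ fun l (_ : l ∈ Finset.univ) =>
    (hX l j).continuousOn_mul (((continuous_id.matrix_elem i l).comp_continuousOn hZ :))
  simpa [Finset.sum_fn, mul_apply] using this

theorem quadratic_entryIntegral {X : ℝ → Matrix n n ℝ} (hX : EntryIntegrable X a b) (x : n → ℝ) :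
    IntervalIntegrable (fun t => x ⬝ᵥ X t *ᵥ x) volume a b ∧
    ∫ t in a..b, x ⬝ᵥ X t *ᵥ x = x ⬝ᵥ entryIntegral X a b *ᵥ x := by
  let φ : Matrix n n ℝ →ₗ[ℝ] ℝ :=
    { toFun := fun M => x ⬝ᵥ M *ᵥ x
      map_add' := fun M N => by rw [add_mulVec, dotProduct_add]
      map_smul' := fun c M => by rw [smul_mulVec, dotProduct_smul]; rfl }
  exact ⟨hX.linearMap φ, integral_linearMap hX φ⟩

theorem isHermitian_entryIntegral {X : ℝ → Matrix n n ℝ} (hab : a ≤ b)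
    (h : ∀ t ∈ Icc a b, (X t).IsHermitian) : (entryIntegral X a b).IsHermitian := by
  ext i j
  refine intervalIntegral.integral_congr fun t ht => ?_
  rw [uIcc_of_le hab] at ht
  simpa using (h t ht).apply i j

theorem posSemidef_entryIntegral {X : ℝ → Matrix n n ℝ} (hab : a ≤ b)
    (hX : EntryIntegrable X a b) (h : ∀ t ∈ Icc a b, (X t).PosSemidef) :
    (entryIntegral X a b).PosSemidef := by
  refine posSemidef_iff_real.2
    ⟨isHermitian_entryIntegral hab fun t ht => (h t ht).isHermitian, fun x => ?_⟩
  rw [← (quadratic_entryIntegral hX x).2]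
  exact intervalIntegral.integral_nonneg hab fun t ht => (h t ht).quadratic_nonneg x

theorem posDef_entryIntegral {X : ℝ → Matrix n n ℝ} (hab : a < b)
    (hX : ContinuousOn X (Icc a b)) (h : ∀ t ∈ Icc a b, (X t).PosDef) :
    (entryIntegral X a b).PosDef := by
  have hX' : EntryIntegrable X a b := ContinuousOn.entryIntegrable (by rwa [uIcc_of_le hab.le])
  refine posDef_iff_real.2
    ⟨isHermitian_entryIntegral hab.le fun t ht => (h t ht).isHermitian, fun x hx => ?_⟩
  rw [← (quadratic_entryIntegral hX' x).2]
  exact intervalIntegral.intervalIntegral_pos_of_pos_on (quadratic_entryIntegral hX' x).1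
    (fun t ht => (posDef_iff_real.1 (h t ⟨ht.1.le, ht.2.le⟩)).2 x hx) hab

end MatrixIntegrals

/-! ### Riccati flows: symmetry, the inverse flow and its trace bound. -/

section Riccati

variable {n : Type*} [Fintype n] [DecidableEq n]

theorem toEuclideanCLM_inv {M : Matrix n n ℝ} (h : IsUnit M) :
    toEuclideanCLM (𝕜 := ℝ) M⁻¹ = Ring.inverse (toEuclideanCLM (𝕜 := ℝ) M) := by
  have h1 : IsUnit (toEuclideanCLM (𝕜 := ℝ) M) := h.map (toEuclideanCLM (n := n) (𝕜 := ℝ))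
  have h2 : toEuclideanCLM (𝕜 := ℝ) M⁻¹ * toEuclideanCLM (𝕜 := ℝ) M = 1 := by
    rw [← map_mul, nonsing_inv_mul _ ((isUnit_iff_isUnit_det _).1 h), map_one]
  rw [← mul_one (toEuclideanCLM (𝕜 := ℝ) M⁻¹), ← Ring.mul_inverse_cancel _ h1, ← mul_assoc, h2,
    one_mul]

theorem continuous_toEuclideanCLM :
    Continuous fun M : Matrix n n ℝ => toEuclideanCLM (𝕜 := ℝ) M :=
  ((toEuclideanCLM (n := n) (𝕜 := ℝ)).toAlgEquiv.toLinearMap).continuous_of_finiteDimensional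

theorem continuous_toEuclideanCLM_symm :
    Continuous fun M : EuclideanSpace ℝ n →L[ℝ] EuclideanSpace ℝ n =>
      (toEuclideanCLM (𝕜 := ℝ)).symm M :=
  ((toEuclideanCLM (n := n) (𝕜 := ℝ)).symm.toAlgEquiv.toLinearMap).continuous_of_finiteDimensional

theorem EntryIntegrable.toEuclideanCLM {X : ℝ → Matrix n n ℝ} {a b : ℝ}
    (hX : EntryIntegrable X a b) :
    IntervalIntegrable (fun t => toEuclideanCLM (𝕜 := ℝ) (X t)) volume a b ∧
    ∫ t in a..b, toEuclideanCLM (𝕜 := ℝ) (X t) = toEuclideanCLM (𝕜 := ℝ) (entryIntegral X a b) :=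
  ⟨hX.linearMap (Matrix.toEuclideanCLM (n := n) (𝕜 := ℝ)).toAlgEquiv.toLinearMap,
    integral_linearMap hX (Matrix.toEuclideanCLM (n := n) (𝕜 := ℝ)).toAlgEquiv.toLinearMap⟩

theorem norm_toEuclideanCLM_le_of_abs_le {M : Matrix n n ℝ} {c : ℝ} (h : ∀ i j, |M i j| ≤ c) :
    ‖toEuclideanCLM (𝕜 := ℝ) M‖ ≤
      c * ∑ i, ∑ j, ‖toEuclideanCLM (𝕜 := ℝ) (Matrix.single (i : n) (j : n) (1 : ℝ))‖ := by
  have := linearMap_apply_eq_sum_entries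
    (toEuclideanCLM (n := n) (𝕜 := ℝ)).toAlgEquiv.toLinearMap M
  change toEuclideanCLM (𝕜 := ℝ) M = _ at this
  rw [this, Finset.mul_sum]
  refine (norm_sum_le _ _).trans (Finset.sum_le_sum fun i _ => ?_)
  rw [Finset.mul_sum]
  refine (norm_sum_le _ _).trans (Finset.sum_le_sum fun j _ => ?_)
  rw [norm_smul]
  refine (mul_le_mul_of_nonneg_right (h i j) (norm_nonneg _)).trans_eq ?_
  congr 2
  change toEuclideanCLM (𝕜 := ℝ) _ = _
  congr!

/-- Matrices are moved to the Banach algebra of operators on Euclidean space, where inversion is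
differentiable, and the identity is pulled back. -/
theorem inv_sub_inv_eq_entryIntegral {S G : ℝ → Matrix n n ℝ} {S0 : Matrix n n ℝ} {T C : ℝ}
    (hT : 0 ≤ T) (hG : EntryIntegrable G 0 T)
    (hC : ∀ t ∈ Icc 0 T, ‖toEuclideanCLM (𝕜 := ℝ) (G t)‖ ≤ C)
    (hS : ∀ t ∈ Icc 0 T, S t = S0 + entryIntegral G 0 t) (hu : ∀ t ∈ Icc 0 T, IsUnit (S t)) :
    ContinuousOn (fun t => (S t)⁻¹) (Icc 0 T) ∧
    (S T)⁻¹ - (S 0)⁻¹ = entryIntegral (fun t => -((S t)⁻¹ * G t * (S t)⁻¹)) 0 T := by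
  obtain ⟨h1, h2⟩ := ringInverse_sub_eq_integral (S := fun t => toEuclideanCLM (𝕜 := ℝ) (S t))
    (S0 := toEuclideanCLM (𝕜 := ℝ) S0) hT hG.toEuclideanCLM.1 hC
    (fun t ht => by
      have hG' : EntryIntegrable G 0 t := fun i j => (hG i j).mono_set
        (uIcc_subset_uIcc left_mem_uIcc (by rwa [uIcc_of_le hT]))
      rw [hG'.toEuclideanCLM.2, ← map_add, hS t ht])
    (fun t ht => (hu t ht).map (toEuclideanCLM (n := n) (𝕜 := ℝ)))
  have hc : ContinuousOn (fun t => (S t)⁻¹) (Icc 0 T) := by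
    refine (continuous_toEuclideanCLM_symm.comp_continuousOn h1).congr fun t ht => ?_
    simp only [Function.comp]
    rw [← toEuclideanCLM_inv (hu t ht), StarAlgEquiv.symm_apply_apply]
  refine ⟨hc, ?_⟩
  have hc' : ContinuousOn (fun t => (S t)⁻¹) (uIcc 0 T) := by rwa [uIcc_of_le hT]
  have hI := ((hG.continuousOn_mul hc').mul_continuousOn hc').neg
  apply EquivLike.injective (toEuclideanCLM (n := n) (𝕜 := ℝ))
  rw [← hI.toEuclideanCLM.2, map_sub, toEuclideanCLM_inv (hu T ⟨hT, le_rfl⟩),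
    toEuclideanCLM_inv (hu 0 ⟨le_rfl, hT⟩), h2]
  refine intervalIntegral.integral_congr fun t ht => ?_
  rw [uIcc_of_le hT] at ht
  simp only [map_neg, map_mul, toEuclideanCLM_inv (hu t ht)]

omit [DecidableEq n] in
theorem continuous_riccati_quadratic (A W : Matrix n n ℝ) :
    Continuous fun Q : Matrix n n ℝ => Q * A + Aᵀ * Q + Q * W * Q :=
  ((continuous_id.matrix_mul continuous_const).add (continuous_const.matrix_mul continuous_id)).add
    ((continuous_id.matrix_mul continuous_const).matrix_mul continuous_id)

/-- Continuous solutions, in integrated form, of a filtering Riccati differential equation with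
bounded measurable information rate `Γ`. -/
structure IsRiccatiFlow (A W S0 : Matrix n n ℝ) (Γ S : ℝ → Matrix n n ℝ) : Prop where
  W_posSemidef : W.PosSemidef
  S0_posDef : S0.PosDef
  measurable : ∀ i j, Measurable fun t => Γ t i j
  bounded : ∃ c, ∀ t i j, |Γ t i j| ≤ c
  posSemidef : ∀ t, (Γ t).PosSemidef
  continuous : Continuous S
  riccati : ∀ t, 0 ≤ t →
    S t = S0 + entryIntegral (fun s => A * S s + S s * Aᵀ + W - S s * Γ s * S s) 0 t

namespace IsRiccatiFlow

variable {A W S0 : Matrix n n ℝ} {Γ S : ℝ → Matrix n n ℝ}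

omit [DecidableEq n] in
theorem transpose_info (h : IsRiccatiFlow A W S0 Γ S) (t : ℝ) : (Γ t)ᵀ = Γ t := by
  simpa using (h.posSemidef t).isHermitian.eq

omit [DecidableEq n] in
theorem info_integrable (h : IsRiccatiFlow A W S0 Γ S) (a b : ℝ) : EntryIntegrable Γ a b :=
  fun i j => by
    obtain ⟨c, hc⟩ := h.bounded
    exact (h.measurable i j).intervalIntegrable_of_abs_le (fun t => hc t i j) a b

omit [DecidableEq n] in
theorem rate_integrable (h : IsRiccatiFlow A W S0 Γ S) (a b : ℝ) :
    EntryIntegrable (fun s => A * S s + S s * Aᵀ + W - S s * Γ s * S s) a b := by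
  have hS := h.continuous
  refine EntryIntegrable.sub (ContinuousOn.entryIntegrable (Continuous.continuousOn ?_)) ?_
  · exact ((continuous_const.matrix_mul hS).add (hS.matrix_mul continuous_const)).add
      continuous_const
  · exact ((h.info_integrable a b).continuousOn_mul hS.continuousOn).mul_continuousOn
      hS.continuousOn

theorem exists_norm_le (h : IsRiccatiFlow A W S0 Γ S) (T : ℝ) : ∃ B c : ℝ, 0 ≤ B ∧ 0 ≤ c ∧
    (∀ t ∈ Icc 0 T, ‖toEuclideanCLM (𝕜 := ℝ) (S t)‖ ≤ B) ∧
    (∀ t ∈ Icc 0 T, ‖toEuclideanCLM (𝕜 := ℝ) (S t)ᵀ‖ ≤ B) ∧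
    ∀ t, ‖toEuclideanCLM (𝕜 := ℝ) (Γ t)‖ ≤ c := by
  obtain ⟨B, hB⟩ := (isCompact_Icc (a := (0 : ℝ)) (b := T)).exists_bound_of_continuousOn
    (continuous_toEuclideanCLM.comp h.continuous).continuousOn
  obtain ⟨B', hB'⟩ := (isCompact_Icc (a := (0 : ℝ)) (b := T)).exists_bound_of_continuousOn
    (continuous_toEuclideanCLM.comp h.continuous.matrix_transpose).continuousOn
  obtain ⟨c, hc⟩ := h.bounded
  have hc' := fun t => norm_toEuclideanCLM_le_of_abs_le (hc t)
  exact ⟨max 0 (max B B'), _, le_max_left _ _, (norm_nonneg _).trans (hc' 0),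
    fun t ht => (hB t ht).trans ((le_max_left _ _).trans (le_max_right _ _)),
    fun t ht => (hB' t ht).trans ((le_max_right _ _).trans (le_max_right _ _)), hc'⟩

theorem exists_norm_rate_le (h : IsRiccatiFlow A W S0 Γ S) (T : ℝ) : ∃ C : ℝ, ∀ t ∈ Icc 0 T,
    ‖toEuclideanCLM (𝕜 := ℝ) (A * S t + S t * Aᵀ + W - S t * Γ t * S t)‖ ≤ C := by
  obtain ⟨B, c, hB0, hc0, hB, -, hc⟩ := h.exists_norm_le T
  refine ⟨‖toEuclideanCLM (𝕜 := ℝ) A‖ * B + B * ‖toEuclideanCLM (𝕜 := ℝ) Aᵀ‖ +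
    ‖toEuclideanCLM (𝕜 := ℝ) W‖ + B * c * B, fun t ht => ?_⟩
  simp only [map_sub, map_add, map_mul]
  refine (norm_sub_le _ _).trans (add_le_add ((norm_add_le _ _).trans (add_le_add
    ((norm_add_le _ _).trans (add_le_add ?_ ?_)) le_rfl)) ?_)
  · exact (norm_mul_le _ _).trans (by gcongr; exact hB t ht)
  · exact (norm_mul_le _ _).trans (by gcongr; exact hB t ht)
  · refine norm_mul₃_le.trans ?_
    gcongr
    · exact hB t ht
    · exact hc t
    · exact hB t ht

/-- The defect D = S - Sᵀ starts at 0 and solves the linear homogeneous equation D' = AD + DAᵀ -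
(DΓS + SᵀΓD) in integrated form, so Grönwall with zero initial bound kills it. -/
theorem isHermitian (h : IsRiccatiFlow A W S0 Γ S) {T : ℝ} (hT : 0 ≤ T) : (S T).IsHermitian := by
  obtain ⟨B, c, hB0, hc0, hB, hB', hc⟩ := h.exists_norm_le T
  set D := fun t => S t - (S t)ᵀ with hD
  have hDc : Continuous D := h.continuous.sub h.continuous.matrix_transpose
  have hWt : Wᵀ = W := by simpa using h.W_posSemidef.isHermitian.eq
  have hS0t : S0ᵀ = S0 := by simpa using h.S0_posDef.isHermitian.eq
  set k := ‖toEuclideanCLM (𝕜 := ℝ) A‖ + ‖toEuclideanCLM (𝕜 := ℝ) Aᵀ‖ + (c * B + B * c) with hk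
  have hk0 : 0 ≤ k := by positivity
  set H := fun s => A * D s + D s * Aᵀ - (D s * Γ s * S s + (S s)ᵀ * Γ s * D s) with hH
  have hHG : ∀ s, H s = (A * S s + S s * Aᵀ + W - S s * Γ s * S s) -
      (A * S s + S s * Aᵀ + W - S s * Γ s * S s)ᵀ := fun s => by
    simp only [hH, hD, transpose_sub, transpose_add, transpose_mul,
      transpose_transpose, hWt, h.transpose_info]
    noncomm_ring
  have hDH : ∀ t, 0 ≤ t → D t = entryIntegral H 0 t := fun t ht => by
    have hG := h.rate_integrable 0 t
    have h1 := entryIntegral_map hG (transposeLinearEquiv n n ℝ ℝ).toLinearMap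
    have h2 := hG.map (transposeLinearEquiv n n ℝ ℝ).toLinearMap
    have h3 := entryIntegral_sub hG h2
    rw [h1] at h3
    rw [funext hHG]
    refine Eq.trans ?_ h3.symm
    simp only [hD]
    rw [h.riccati t ht, transpose_add, hS0t, add_sub_add_left_eq_sub]
    rfl
  have hHI : ∀ t, EntryIntegrable H 0 t := fun t => by
    have hG := h.rate_integrable 0 t
    rw [funext hHG]
    exact hG.sub (hG.map (transposeLinearEquiv n n ℝ ℝ).toLinearMap)
  have hHn : ∀ t ∈ Icc 0 T, ‖toEuclideanCLM (𝕜 := ℝ) (H t)‖ ≤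
      k * ‖toEuclideanCLM (𝕜 := ℝ) (D t)‖ := fun t ht => by
    simp only [hH, map_sub, map_add, map_mul, hk, add_mul]
    refine (norm_sub_le _ _).trans (add_le_add ((norm_add_le _ _).trans (add_le_add
      (norm_mul_le _ _) ((norm_mul_le _ _).trans_eq (mul_comm _ _))))
        ((norm_add_le _ _).trans (add_le_add ?_ ?_)))
    · rw [mul_assoc c, mul_comm B, ← mul_assoc, mul_comm c]
      refine norm_mul₃_le.trans ?_
      gcongr
      · exact hc t
      · exact hB t ht
    · refine norm_mul₃_le.trans ?_
      gcongr
      · exact hB' t ht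
      · exact hc t
  have hu : Continuous fun t => ‖toEuclideanCLM (𝕜 := ℝ) (D t)‖ :=
    (continuous_toEuclideanCLM.comp hDc).norm
  have hg := le_exp_of_le_add_mul_integral (a := 0) (T := T) hk0 hu.continuousOn (fun t ht => by
    rw [zero_add, ← intervalIntegral.integral_const_mul]
    nth_rewrite 1 [hDH t ht.1]
    rw [← (hHI t).toEuclideanCLM.2]
    refine (intervalIntegral.norm_integral_le_integral_norm ht.1).trans ?_
    refine intervalIntegral.integral_mono_on ht.1 (hHI t).toEuclideanCLM.1.norm
      ((hu.const_mul k).intervalIntegrable _ _) fun s hs => hHn s ⟨hs.1, hs.2.trans ht.2⟩) T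
    ⟨hT, le_rfl⟩
  rw [zero_mul, norm_le_zero_iff,
    map_eq_zero_iff _ (EquivLike.injective (toEuclideanCLM (n := n) (𝕜 := ℝ))),
    sub_eq_zero] at hg
  rw [IsHermitian, conjTranspose_eq_transpose_of_trivial]
  exact hg.symm

omit [DecidableEq n] in
theorem apply_zero (h : IsRiccatiFlow A W S0 Γ S) : S 0 = S0 := by
  rw [h.riccati 0 le_rfl]
  ext i j
  simp [entryIntegral]

theorem inv_eq (h : IsRiccatiFlow A W S0 Γ S) {T : ℝ} (hT : 0 ≤ T)
    (hpd : ∀ t ∈ Icc 0 T, (S t).PosDef) :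
    ContinuousOn (fun t => (S t)⁻¹) (Icc 0 T) ∧
    (S T)⁻¹ = S0⁻¹ + entryIntegral (fun t => Γ t -
      ((S t)⁻¹ * A + Aᵀ * (S t)⁻¹ + (S t)⁻¹ * W * (S t)⁻¹)) 0 T := by
  obtain ⟨C, hC⟩ := h.exists_norm_rate_le T
  obtain ⟨h1, h2⟩ := inv_sub_inv_eq_entryIntegral hT (h.rate_integrable 0 T) hC
    (fun t ht => h.riccati t ht.1) (fun t ht => (hpd t ht).isUnit)
  refine ⟨h1, ?_⟩
  rw [sub_eq_iff_eq_add', h.apply_zero] at h2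
  rw [h2]
  congr 1
  ext i j
  refine intervalIntegral.integral_congr fun t ht => ?_
  rw [uIcc_of_le hT] at ht
  have hdet := (isUnit_iff_isUnit_det _).1 (hpd t ht).isUnit
  have e : -((S t)⁻¹ * (A * S t + S t * Aᵀ + W - S t * Γ t * S t) * (S t)⁻¹) =
      Γ t - ((S t)⁻¹ * A + Aᵀ * (S t)⁻¹ + (S t)⁻¹ * W * (S t)⁻¹) := by
    have e1 : (S t)⁻¹ * (A * S t) * (S t)⁻¹ = (S t)⁻¹ * A := by
      rw [mul_assoc, mul_assoc, mul_nonsing_inv _ hdet, mul_one]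
    have e2 : (S t)⁻¹ * (S t * Aᵀ) * (S t)⁻¹ = Aᵀ * (S t)⁻¹ := by
      rw [← mul_assoc, nonsing_inv_mul _ hdet, one_mul]
    have e3 : (S t)⁻¹ * (S t * Γ t * S t) * (S t)⁻¹ = Γ t := by
      rw [mul_assoc (S t), ← mul_assoc, nonsing_inv_mul _ hdet, one_mul, mul_assoc,
        mul_nonsing_inv _ hdet, mul_one]
    rw [mul_sub, mul_add, mul_add, sub_mul, add_mul, add_mul, e1, e2, e3]
    abel
  simp only [e]

/-- For Q = S⁻¹ the term -QWQ only decreases the trace, leaving the linear bound (Tr Q)' ≤ c' + k Tr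
Q. The resulting K is independent of t, so it remains valid up to a first time at which definiteness
might fail. -/
theorem exists_trace_inv_le (h : IsRiccatiFlow A W S0 Γ S) (T : ℝ) : ∃ K : ℝ, 0 < K ∧
    ∀ t ∈ Icc 0 T, (∀ s ∈ Icc 0 t, (S s).PosDef) → (S t)⁻¹.trace ≤ K := by
  obtain ⟨c, hc⟩ := h.bounded
  set c' : ℝ := ∑ _i : n, |c| with hc'
  have hc'0 : 0 ≤ c' := by positivity
  set k : ℝ := ∑ i, ∑ j, |(A + Aᵀ) i j| with hk
  have hk0 : 0 ≤ k := by positivity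
  have hkA : (k • 1 + (A + Aᵀ)).PosSemidef := by
    refine posSemidef_iff_real.2 ⟨(isHermitian_smul_one k).add ?_, fun x => ?_⟩
    · rw [IsHermitian, conjTranspose_eq_transpose_of_trivial]
      simp [add_comm]
    · have := (neg_abs_le _).trans' (neg_le_neg (abs_quadratic_le (A + Aᵀ) x))
      rw [add_mulVec, dotProduct_add, smul_mulVec, one_mulVec, dotProduct_smul, smul_eq_mul]
      linarith
  have htr0 : 0 ≤ S0⁻¹.trace := h.S0_posDef.inv.posSemidef.trace_nonneg
  -- The `+ 1` keeps K positive even in state dimension zero.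
  refine ⟨(S0⁻¹.trace + c' * |T|) * Real.exp (k * |T|) + 1, by positivity, fun t ht hpd => ?_⟩
  have hQc := (h.inv_eq ht.1 hpd).1
  have hfc : ContinuousOn (fun s => (S s)⁻¹.trace) (Icc 0 t) :=
    continuous_id.matrix_trace.comp_continuousOn hQc
  have hg := le_exp_of_le_add_mul_integral (a := S0⁻¹.trace + c' * |T|) (T := t) hk0 hfc
    (fun s hs => by
      have hpd' : ∀ r ∈ Icc 0 s, (S r).PosDef := fun r hr => hpd r ⟨hr.1, hr.2.trans hs.2⟩
      obtain ⟨hQs, hQ⟩ := h.inv_eq hs.1 hpd'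
      have hQu : ContinuousOn (fun t => (S t)⁻¹) (uIcc 0 s) := by rwa [uIcc_of_le hs.1]
      have hI : EntryIntegrable (fun t => Γ t -
          ((S t)⁻¹ * A + Aᵀ * (S t)⁻¹ + (S t)⁻¹ * W * (S t)⁻¹)) 0 s := by
        refine (h.info_integrable 0 s).sub (ContinuousOn.entryIntegrable ?_)
        exact (continuous_riccati_quadratic A W).comp_continuousOn hQu
      have hfs : IntervalIntegrable (fun s => (S s)⁻¹.trace) volume 0 s :=
        ContinuousOn.intervalIntegrable (continuous_id.matrix_trace.comp_continuousOn hQu)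
      have htr := integral_linearMap hI (traceLinearMap n ℝ ℝ)
      have htrI := hI.linearMap (traceLinearMap n ℝ ℝ)
      simp only [traceLinearMap_apply] at htr htrI
      rw [hQ, trace_add, ← htr, add_assoc]
      gcongr
      have h1 : ∫ r in (0 : ℝ)..s, (c' + k * (S r)⁻¹.trace) =
          c' * s + k * ∫ r in (0 : ℝ)..s, (S r)⁻¹.trace := by
        rw [intervalIntegral.integral_add (by simp) (hfs.const_mul k),
          intervalIntegral.integral_const_mul]
        simp [mul_comm]
      have h2 : c' * s ≤ c' * |T| :=
        mul_le_mul_of_nonneg_left ((hs.2.trans ht.2).trans (le_abs_self T)) hc'0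
      refine le_trans ?_ ((h1.le).trans (by linarith))
      refine intervalIntegral.integral_mono_on hs.1 htrI
        (IntervalIntegrable.add (by simp) (hfs.const_mul k)) fun r hr => ?_
      have hq := (hpd' r hr).inv.posSemidef
      have hqt : ((S r)⁻¹)ᵀ = (S r)⁻¹ := by simpa using hq.isHermitian.eq
      have h3 : (Γ r).trace ≤ c' :=
        Finset.sum_le_sum fun i _ => (le_abs_self _).trans ((hc r i i).trans (le_abs_self c))
      have h4 := hq.trace_mul_nonneg hkA
      have h5 : 0 ≤ ((S r)⁻¹ * W * (S r)⁻¹).trace := by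
        have := h.W_posSemidef.conjTranspose_mul_mul_same (S r)⁻¹
        rw [conjTranspose_eq_transpose_of_trivial, hqt] at this
        exact this.trace_nonneg
      rw [mul_add, mul_add, trace_add, trace_add, mul_smul_comm, mul_one, trace_smul,
        smul_eq_mul] at h4
      rw [trace_sub, trace_add, trace_add, trace_mul_comm Aᵀ]
      linarith) t ⟨ht.1, le_rfl⟩
  refine hg.trans ?_
  have h1 : Real.exp (k * t) ≤ Real.exp (k * |T|) :=
    Real.exp_le_exp.2 (mul_le_mul_of_nonneg_left (ht.2.trans (le_abs_self T)) hk0)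
  have h2 : 0 ≤ S0⁻¹.trace + c' * |T| := by positivity
  nlinarith

end IsRiccatiFlow

end Riccati

/-! ### Positivity and time averages of Riccati flows. -/

section RiccatiAverage

variable {n : Type*} [Fintype n] [DecidableEq n]

omit [DecidableEq n] in
theorem continuous_quadratic (x : n → ℝ) : Continuous fun M : Matrix n n ℝ => x ⬝ᵥ M *ᵥ x :=
  continuous_const.dotProduct (continuous_id.matrix_mulVec continuous_const)

theorem Matrix.PosDef.eventually_nhds {M : Matrix n n ℝ} (h : M.PosDef) :
    ∀ᶠ X in 𝓝 M, X.IsHermitian → X.PosDef := by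
  obtain ⟨m, hm, hM⟩ := h.exists_smul_one_le
  have hc : Continuous fun X : Matrix n n ℝ => ∑ i, ∑ j, |(X - M) i j| :=
    continuous_finsetSum _ fun i _ => continuous_finsetSum _ fun j _ =>
      ((continuous_id.sub continuous_const).matrix_elem i j).abs
  have h1 := hc.tendsto M
  simp only [sub_self, Matrix.zero_apply, abs_zero, Finset.sum_const_zero] at h1
  filter_upwards [h1.eventually_lt_const (half_pos hm)] with X hX hXs
  refine PosDef.of_smul_one_le hXs (half_pos hm) fun x => ?_
  have h2 := (neg_le_neg (abs_quadratic_le (X - M) x)).trans (neg_abs_le _)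
  have h3 : 0 ≤ x ⬝ᵥ x := by simpa using dotProduct_star_self_nonneg x
  rw [sub_mulVec, dotProduct_sub] at h2
  nlinarith [hM x]

namespace IsRiccatiFlow

variable {A W S0 : Matrix n n ℝ} {Γ S : ℝ → Matrix n n ℝ}

/-- Continuation to the infimum r of the bad times: before r the trace bound gives S ≽ I/K, which
passes to the limit at r; definiteness is open among symmetric matrices, so no bad times can
accumulate at r. -/
theorem posDef (h : IsRiccatiFlow A W S0 Γ S) {t : ℝ} (ht : 0 ≤ t) : (S t).PosDef := by
  by_contra hbad
  set B := {s : ℝ | 0 ≤ s ∧ ¬ (S s).PosDef} with hB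
  have hBne : B.Nonempty := ⟨t, ht, hbad⟩
  have hBb : BddBelow B := ⟨0, fun s hs => hs.1⟩
  set r := sInf B with hr
  have hr0 : 0 ≤ r := le_csInf hBne fun s hs => hs.1
  have hlt : ∀ s, 0 ≤ s → s < r → (S s).PosDef := fun s hs0 hs => by
    by_contra hc
    exact (csInf_le hBb ⟨hs0, hc⟩).not_gt hs
  have hSr : (S r).PosDef := by
    rcases hr0.eq_or_lt with h0 | h0
    · rw [← h0, h.apply_zero]
      exact h.S0_posDef
    · obtain ⟨K, hK, hKb⟩ := h.exists_trace_inv_le r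
      refine PosDef.of_smul_one_le (m := 1 / K) (h.isHermitian hr0) (by positivity) fun x => ?_
      have h1 : Tendsto (fun s => x ⬝ᵥ S s *ᵥ x) (𝓝[<] r) (𝓝 (x ⬝ᵥ S r *ᵥ x)) :=
        tendsto_nhdsWithin_of_tendsto_nhds
          (((continuous_quadratic x).comp h.continuous).tendsto r)
      refine ge_of_tendsto h1 ?_
      filter_upwards [Ioo_mem_nhdsLT h0] with s hs
      have hpd := hlt s hs.1.le hs.2
      refine hpd.smul_le_quadratic hK ((hpd.inv.posSemidef.quadratic_le_trace x).trans ?_)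
      refine mul_le_mul_of_nonneg_right ?_ (by simpa using dotProduct_star_self_nonneg x)
      exact hKb s ⟨hs.1.le, hs.2.le⟩ fun q hq => hlt q hq.1 (hq.2.trans_lt hs.2)
  have hev := (h.continuous.tendsto r).eventually hSr.eventually_nhds
  obtain ⟨ε, hε, hball⟩ := Metric.eventually_nhds_iff.1 hev
  obtain ⟨s, hs, hsr⟩ := exists_lt_of_csInf_lt hBne (lt_add_of_pos_right r hε)
  refine hs.2 (hball ?_ (h.isHermitian hs.1))
  have := csInf_le hBb hs
  rw [Real.dist_eq, abs_of_nonneg (by linarith)]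
  linarith

omit [Fintype n] [DecidableEq n] in
theorem _root_.entryIntegral_const {M : Matrix n n ℝ} {τ : ℝ} :
    entryIntegral (fun _ => M) 0 τ = τ • M := by
  ext i j
  simp [entryIntegral]

/-- The time averages of the inverse of a Riccati flow and of the information rate satisfy the
Riccati inequality up to an error of order `1 / τ`. -/
theorem exists_average (h : IsRiccatiFlow A W S0 Γ S) {τ : ℝ} (hτ : 0 < τ) :
    ∃ Q : Matrix n n ℝ, Q.PosDef ∧
      (τ⁻¹ • S0⁻¹ - (Q * A + Aᵀ * Q + Q * W * Q - τ⁻¹ • entryIntegral Γ 0 τ)).PosSemidef ∧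
      ∀ T : Matrix n n ℝ, T.PosSemidef →
        (T * Q⁻¹).trace ≤ τ⁻¹ * ∫ t in (0 : ℝ)..τ, (T * S t).trace := by
  have hpd : ∀ t ∈ Icc 0 τ, (S t).PosDef := fun t ht => h.posDef ht.1
  obtain ⟨hQc, hQ⟩ := h.inv_eq hτ.le hpd
  have hQu : ContinuousOn (fun t => (S t)⁻¹) (uIcc 0 τ) := by rwa [uIcc_of_le hτ.le]
  have hI1 : EntryIntegrable (fun t => (S t)⁻¹) 0 τ := hQu.entryIntegrable
  set I := entryIntegral (fun t => (S t)⁻¹) 0 τ with hI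
  set Q := τ⁻¹ • I with hQdef
  have hIQ : I = τ • Q := by rw [hQdef, smul_smul, mul_inv_cancel₀ hτ.ne', one_smul]
  have hQpd : Q.PosDef := (posDef_entryIntegral hτ hQc fun t ht => (hpd t ht).inv).smul
    (inv_pos.2 hτ)
  refine ⟨Q, hQpd, ?_, fun T hT => ?_⟩
  · let φ : Matrix n n ℝ →ₗ[ℝ] Matrix n n ℝ :=
      LinearMap.mulRight ℝ A + LinearMap.mulLeft ℝ Aᵀ
    -- ψ(M) - QWQ is the tangent of M ↦ MWM at the mean Q. Its average is QWQ, so the average of the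
    -- gap to the tangent is exactly the Jensen defect.
    let ψ : Matrix n n ℝ →ₗ[ℝ] Matrix n n ℝ :=
      LinearMap.mulRight ℝ (W * Q) + LinearMap.mulLeft ℝ (Q * W)
    have hφ : ∀ M, φ M = M * A + Aᵀ * M := fun M => rfl
    have hψ : ∀ M, ψ M = M * (W * Q) + Q * W * M := fun M => rfl
    have hJ : EntryIntegrable (fun t => (S t)⁻¹ * W * (S t)⁻¹ - (ψ (S t)⁻¹ - Q * W * Q)) 0 τ := by
      refine ContinuousOn.entryIntegrable ?_
      have hc : Continuous fun M : Matrix n n ℝ => M * W * M -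
          (M * (W * Q) + Q * W * M - Q * W * Q) := by fun_prop
      exact hc.comp_continuousOn hQu
    have hJpsd := posSemidef_entryIntegral hτ.le hJ fun t ht => by
      have := posSemidef_conj_sub_tangent h.W_posSemidef (hpd t ht).inv.isHermitian
        hQpd.isHermitian
      rw [hψ, ← mul_assoc]
      exact this
    have hconst : EntryIntegrable (fun _ : ℝ => Q * W * Q) 0 τ :=
      continuousOn_const.entryIntegrable
    have e1 := entryIntegral_sub (h.info_integrable 0 τ)
      ((hI1.map φ).add (hJ.add ((hI1.map ψ).sub hconst)))
    rw [entryIntegral_add (hI1.map φ) (hJ.add ((hI1.map ψ).sub hconst)),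
      entryIntegral_add hJ ((hI1.map ψ).sub hconst), entryIntegral_sub (hI1.map ψ) hconst,
      entryIntegral_map hI1, entryIntegral_map hI1, entryIntegral_const, ← hI] at e1
    have e2 : (fun t => Γ t - ((S t)⁻¹ * A + Aᵀ * (S t)⁻¹ + (S t)⁻¹ * W * (S t)⁻¹)) =
        fun t => Γ t - (φ (S t)⁻¹ + ((S t)⁻¹ * W * (S t)⁻¹ - (ψ (S t)⁻¹ - Q * W * Q) +
          (ψ (S t)⁻¹ - Q * W * Q))) := by
      funext t
      rw [hφ]; abel
    rw [e2, e1] at hQ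
    -- The required matrix equals 1/τ times S(τ)⁻¹ plus the integrated Jensen gap.
    have h1 := ((hpd τ ⟨hτ.le, le_rfl⟩).inv.posSemidef.add hJpsd).smul (inv_pos.2 hτ).le
    refine Eq.mp (congrArg Matrix.PosSemidef ?_) h1
    rw [hQ, hφ, hψ, hIQ]
    simp only [smul_mul_assoc, mul_smul_comm, smul_add, smul_sub, smul_smul, ← mul_assoc,
      inv_mul_cancel₀ hτ.ne', one_smul]
    abel
  · set X := Q⁻¹ with hX
    have hdet := (isUnit_iff_isUnit_det _).1 hQpd.isUnit
    -- Jensen for inversion: S ≽ 2X - XS⁻¹X with X = Q⁻¹, and the right side averages to 2X - XQX =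
    -- X.
    let φ : Matrix n n ℝ →ₗ[ℝ] ℝ :=
      traceLinearMap n ℝ ℝ ∘ₗ LinearMap.mulLeft ℝ (T * X) ∘ₗ LinearMap.mulRight ℝ X
    have hφ : ∀ M, φ M = (T * X * (M * X)).trace := fun M => rfl
    have h1 : ∀ t ∈ Icc 0 τ, (T * (X + X)).trace - φ (S t)⁻¹ ≤ (T * S t).trace := fun t ht => by
      have := posSemidef_inv_sub_tangent (hpd t ht).inv hQpd.inv.isHermitian
      rw [nonsing_inv_nonsing_inv _ ((isUnit_iff_isUnit_det _).1 (hpd t ht).isUnit)] at this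
      have h2 := trace_mul_le_of_posSemidef_sub hT this
      rw [mul_sub, trace_sub] at h2
      rw [hφ]
      simpa only [mul_assoc] using h2
    have h2 : ∫ t in (0 : ℝ)..τ, ((T * (X + X)).trace - φ (S t)⁻¹) = τ * (T * X).trace := by
      rw [intervalIntegral.integral_sub (by simp) (hI1.linearMap φ), integral_linearMap hI1, ← hI,
        hIQ, hφ, smul_mul_assoc, mul_nonsing_inv _ hdet]
      simp [mul_add]
    have h3 := intervalIntegral.integral_mono_on hτ.le
      (IntervalIntegrable.sub (by simp) (hI1.linearMap φ))
      ((continuous_const.matrix_mul h.continuous).matrix_trace.intervalIntegrable 0 τ) h1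
    rw [h2] at h3
    rwa [inv_mul_eq_div, le_div_iff₀ hτ, mul_comm]

end IsRiccatiFlow

end RiccatiAverage

/-! ### Convexity of the Riccati expression and of matrix inversion. -/

section ConvexityOfMatrixFunctions

variable {n : Type*} [Fintype n] [DecidableEq n]

omit [Fintype n] [DecidableEq n] in
theorem Matrix.PosDef.convexCombination [Finite n] {X Y : Matrix n n ℝ} (hX : X.PosDef)
    (hY : Y.PosDef) {a b : ℝ} (ha : 0 ≤ a) (hb : 0 ≤ b) (hab : a + b = 1) :
    (a • X + b • Y).PosDef := by
  rcases ha.eq_or_lt with rfl | ha'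
  · have : b = 1 := by linarith
    simpa [this] using hY
  · exact (hX.smul ha').add_posSemidef (hY.posSemidef.smul hb)

omit [DecidableEq n] in
-- Only QWQ is nonlinear, and its convexity gap is exactly ab(X - Y)W(X - Y).
theorem posSemidef_riccati_sub_convexCombination {A W Γ₁ Γ₂ X Y : Matrix n n ℝ}
    (hW : W.PosSemidef) (hX : X.IsHermitian) (hY : Y.IsHermitian) {a b : ℝ} (ha : 0 ≤ a)
    (hb : 0 ≤ b) (hab : a + b = 1) :
    (-((a • X + b • Y) * A + Aᵀ * (a • X + b • Y) + (a • X + b • Y) * W * (a • X + b • Y) -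
        (a • Γ₁ + b • Γ₂)) -
      (a • (-(X * A + Aᵀ * X + X * W * X - Γ₁)) +
        b • (-(Y * A + Aᵀ * Y + Y * W * Y - Γ₂)))).PosSemidef := by
  have h := hW.conjTranspose_mul_mul_same (X - Y)
  rw [(hX.sub hY).eq] at h
  refine Eq.mp (congrArg Matrix.PosSemidef ?_) (h.smul (mul_nonneg ha hb))
  obtain rfl : b = 1 - a := by linarith
  simp only [Matrix.add_mul, Matrix.mul_add, Matrix.sub_mul, Matrix.mul_sub, Matrix.smul_mul,
    Matrix.mul_smul, smul_add, smul_sub, smul_smul]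
  module

/-- Combine the tangent inequalities for X⁻¹ and Y⁻¹, both with tangent point Z = aX + bY. -/
theorem posSemidef_convexCombination_inv_sub {X Y : Matrix n n ℝ} (hX : X.PosDef) (hY : Y.PosDef)
    {a b : ℝ} (ha : 0 ≤ a) (hb : 0 ≤ b) (hab : a + b = 1) :
    (a • X⁻¹ + b • Y⁻¹ - (a • X + b • Y)⁻¹).PosSemidef := by
  have hZ := hX.convexCombination hY ha hb hab
  have hdet := (isUnit_iff_isUnit_det _).1 hZ.isUnit
  set Z := a • X + b • Y with hZd
  have h1 := (posSemidef_inv_sub_tangent hX hZ.inv.isHermitian).smul ha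
  have h2 := (posSemidef_inv_sub_tangent hY hZ.inv.isHermitian).smul hb
  refine Eq.mp (congrArg Matrix.PosSemidef ?_) (h1.add h2)
  have e : a • (Z⁻¹ * X * Z⁻¹) + b • (Z⁻¹ * Y * Z⁻¹) = Z⁻¹ := by
    have h3 : Z⁻¹ * (a • X + b • Y) * Z⁻¹ = Z⁻¹ := by
      rw [← hZd, nonsing_inv_mul _ hdet, one_mul]
    simpa only [mul_add, add_mul, mul_smul_comm, smul_mul_assoc] using h3
  have e2 : a • Z⁻¹ + b • Z⁻¹ = Z⁻¹ := by rw [← add_smul, hab, one_smul]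
  have e3 : a • (X⁻¹ - (Z⁻¹ + Z⁻¹ - Z⁻¹ * X * Z⁻¹)) + b • (Y⁻¹ - (Z⁻¹ + Z⁻¹ - Z⁻¹ * Y * Z⁻¹)) =
      a • X⁻¹ + b • Y⁻¹ - ((a • Z⁻¹ + b • Z⁻¹) + (a • Z⁻¹ + b • Z⁻¹)) +
        (a • (Z⁻¹ * X * Z⁻¹) + b • (Z⁻¹ * Y * Z⁻¹)) := by
    module
  rw [e3, e, e2]
  abel

theorem posSemidef_neg_fromBlocks_iff {F Q W B : Matrix n n ℝ} (hQ : Q.IsHermitian)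
    (hB : B.IsHermitian) (hBW : B * B = W) :
    (-(fromBlocks F (Q * B) (B * Q) (-1))).PosSemidef ↔ (-(F + Q * W * Q)).PosSemidef := by
  have : Invertible (1 : Matrix n n ℝ) := invertibleOne
  have h1 := (PosDef.one (n := n) (R := ℝ)).fromBlocks₂₂ (-F) (-(Q * B))
  have e1 : (-(Q * B))ᴴ = -(B * Q) := by
    rw [conjTranspose_neg, conjTranspose_mul, hQ.eq, hB.eq]
  have e2 : -F - -(Q * B) * 1⁻¹ * -(B * Q) = -(F + Q * W * Q) := by
    rw [inv_one, mul_one, ← hBW]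
    noncomm_ring
  rw [e1, e2] at h1
  rw [fromBlocks_neg, neg_neg]
  exact h1

end ConvexityOfMatrixFunctions

/-! ### Mixtures, averages and a positive element of the constraint set. -/

namespace IsSubstochastic

variable {N M : ℕ} {busy covered : Prop}

theorem convexCombination {p q : Fin N → Fin M → ℝ} (hp : IsSubstochastic busy covered p)
    (hq : IsSubstochastic busy covered q) {a b : ℝ} (ha : 0 ≤ a) (hb : 0 ≤ b) (hab : a + b = 1) :
    IsSubstochastic busy covered (a • p + b • q) := by
  have hle : ∀ x y : ℝ, x ≤ 1 → y ≤ 1 → a * x + b * y ≤ 1 := fun x y hx hy => by nlinarith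
  constructor
  · intro i j
    exact add_nonneg (mul_nonneg ha (hp.nonneg i j)) (mul_nonneg hb (hq.nonneg i j))
  · exact fun i j => hle _ _ (hp.le_one i j) (hq.le_one i j)
  · intro j
    simpa [Finset.sum_add_distrib, ← Finset.mul_sum] using hle _ _ (hp.col_le j) (hq.col_le j)
  · intro i
    simpa [Finset.sum_add_distrib, ← Finset.mul_sum] using hle _ _ (hp.row_le i) (hq.row_le i)
  · intro hbusy j
    simpa [Finset.sum_add_distrib, ← Finset.mul_sum, hp.col_eq hbusy j, hq.col_eq hbusy j] using hab
  · intro hcov i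
    simpa [Finset.sum_add_distrib, ← Finset.mul_sum, hp.row_eq hcov i, hq.row_eq hcov i] using hab

/-- Column sums are N / max(N, M) and row sums M / max(N, M); the size conditions turn them into 1
where equality is demanded. All entries are positive, so every sensor informs every plant. -/
theorem uniform (hbusy : busy → M ≤ N) (hcovered : covered → N ≤ M) :
    IsSubstochastic busy covered fun (_ : Fin N) (_ : Fin M) => ((max N M : ℕ) : ℝ)⁻¹ := by
  have hmul : ∀ k : ℕ, k ≤ max N M → (k : ℝ) * ((max N M : ℕ) : ℝ)⁻¹ ≤ 1 := fun k hk => by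
    rw [← div_eq_mul_inv]
    exact div_le_one_of_le₀ (by exact_mod_cast hk) (by positivity)
  refine ⟨fun i j => by positivity, fun i j => ?_, fun j => ?_, fun i => ?_, fun h j => ?_,
    fun h i => ?_⟩
  · have := hmul 1 (le_max_of_le_left (Nat.one_le_of_lt i.2))
    simpa using this
  · simpa using hmul N (le_max_left _ _)
  · simpa using hmul M (le_max_right _ _)
  · have hN : N ≠ 0 := by have := j.2; have := hbusy h; omega
    simp [max_eq_left (hbusy h), hN]
  · have hM : M ≠ 0 := by have := i.2; have := hcovered h; omega
    simp [max_eq_right (hcovered h), hM]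

theorem average {π : ℝ → Fin N → Fin M → ℝ} {τ : ℝ} (hτ : 0 < τ)
    (hint : ∀ i j, IntervalIntegrable (fun t => π t i j) volume 0 τ)
    (h : ∀ t ∈ Icc 0 τ, IsSubstochastic busy covered (π t)) :
    IsSubstochastic busy covered fun i j => τ⁻¹ * ∫ t in (0 : ℝ)..τ, π t i j := by
  have hle : ∀ f : ℝ → ℝ, IntervalIntegrable f volume 0 τ → (∀ t ∈ Icc 0 τ, f t ≤ 1) →
      τ⁻¹ * ∫ t in (0 : ℝ)..τ, f t ≤ 1 := fun f hf h1 => by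
    have := intervalIntegral.integral_mono_on hτ.le hf (intervalIntegrable_const (c := (1 : ℝ))) h1
    rw [intervalIntegral.integral_const, smul_eq_mul, mul_one, sub_zero] at this
    rwa [inv_mul_le_iff₀ hτ, mul_one]
  have heq : ∀ f : ℝ → ℝ, (∀ t ∈ Icc 0 τ, f t = 1) →
      τ⁻¹ * ∫ t in (0 : ℝ)..τ, f t = 1 := fun f h1 => by
    have : ∫ t in (0 : ℝ)..τ, f t = ∫ t in (0 : ℝ)..τ, (1 : ℝ) :=
      intervalIntegral.integral_congr fun t ht => h1 t (by rwa [uIcc_of_le hτ.le] at ht)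
    rw [this, intervalIntegral.integral_const, smul_eq_mul, mul_one, sub_zero,
      inv_mul_cancel₀ hτ.ne']
  have hsum : ∀ {ι : Type} (s : Finset ι) (f : ι → ℝ → ℝ),
      (∀ i, IntervalIntegrable (f i) volume 0 τ) →
      IntervalIntegrable (fun t => ∑ i ∈ s, f i t) volume 0 τ ∧
      ∑ i ∈ s, τ⁻¹ * ∫ t in (0 : ℝ)..τ, f i t = τ⁻¹ * ∫ t in (0 : ℝ)..τ, ∑ i ∈ s, f i t :=
    fun s f hf => by
      refine ⟨?_, ?_⟩
      · simpa [Finset.sum_fn] using IntervalIntegrable.sum s fun i _ => hf i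
      · rw [← Finset.mul_sum, intervalIntegral.integral_finsetSum fun i _ => hf i]
  constructor
  · intro i j
    exact mul_nonneg (inv_nonneg.2 hτ.le)
      (intervalIntegral.integral_nonneg hτ.le fun t ht => (h t ht).nonneg i j)
  · exact fun i j => hle _ (hint i j) fun t ht => (h t ht).le_one i j
  · intro j
    obtain ⟨h1, h2⟩ := hsum Finset.univ (fun i t => π t i j) fun i => hint i j
    rw [h2]
    exact hle _ h1 fun t ht => (h t ht).col_le j
  · intro i
    obtain ⟨h1, h2⟩ := hsum Finset.univ (fun j t => π t i j) fun j => hint i j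
    rw [h2]
    exact hle _ h1 fun t ht => (h t ht).row_le i
  · intro hb j
    rw [(hsum Finset.univ (fun i t => π t i j) fun i => hint i j).2]
    exact heq _ fun t ht => (h t ht).col_eq hb j
  · intro hc i
    rw [(hsum Finset.univ (fun j t => π t i j) fun j => hint i j).2]
    exact heq _ fun t ht => (h t ht).row_eq hc i

end IsSubstochastic

/-! ### The two programs: convexity, Slater point, equivalence and finite value. -/

namespace SchedulingProblem

variable {N M : ℕ} {P : SchedulingProblem N M} {busy covered : Prop}

theorem info_convexCombination (a b : ℝ) (p q : Fin N → Fin M → ℝ) (i : Fin N) :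
    P.info (a • p + b • q) i = a • P.info p i + b • P.info q i := by
  simp only [info, Finset.smul_sum, ← Finset.sum_add_distrib]
  refine Finset.sum_congr rfl fun j _ => ?_
  simp only [Pi.add_apply, Pi.smul_apply, smul_eq_mul, add_smul, smul_smul]

theorem StandingAssumptions.info_posSemidef (hP : P.StandingAssumptions) {p : Fin N → Fin M → ℝ}
    {i : Fin N} (hp : ∀ j, 0 ≤ p i j) : (P.info p i).PosSemidef := by
  refine posSemidef_sum _ fun j _ => PosSemidef.smul ?_ (hp j)
  simpa using (hP.V_posDef i j).inv.posSemidef.conjTranspose_mul_mul_same (P.C i j)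

theorem quadratic_stackedC (i : Fin N) (J : Finset (Fin M)) (x : Fin (P.n i) → ℝ) :
    x ⬝ᵥ ((P.stackedC i J)ᵀ * P.stackedC i J) *ᵥ x =
      ∑ j ∈ J, (P.C i j *ᵥ x) ⬝ᵥ (P.C i j *ᵥ x) := by
  rw [← mulVec_mulVec, dotProduct_mulVec, vecMul_transpose]
  rw [← Finset.sum_coe_sort J]
  simp only [dotProduct, Fintype.sum_sigma]
  rfl

theorem quadratic_info (p : Fin N → Fin M → ℝ) (i : Fin N) (x : Fin (P.n i) → ℝ) :
    x ⬝ᵥ P.info p i *ᵥ x =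
      ∑ j, p i j * ((P.C i j *ᵥ x) ⬝ᵥ (P.V i j)⁻¹ *ᵥ (P.C i j *ᵥ x)) := by
  simp only [info, sum_mulVec, dotProduct_sum, smul_mulVec, dotProduct_smul, smul_eq_mul]
  refine Finset.sum_congr rfl fun j _ => ?_
  rw [← mulVec_mulVec, ← mulVec_mulVec, dotProduct_mulVec x, vecMul_transpose]

/-- Each V⁻¹ dominates a positive multiple of the identity, so c below all p m works; sensors
outside J add nonnegative terms. This links detectability to the weighted information matrix. -/
theorem StandingAssumptions.exists_stackedC_le_info (hP : P.StandingAssumptions)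
    {p : Fin N → Fin M → ℝ} {i : Fin N} (hp : ∀ j, 0 < p i j) (J : Finset (Fin M)) :
    ∃ c : ℝ, 0 < c ∧ (P.info p i - c • ((P.stackedC i J)ᵀ * P.stackedC i J)).PosSemidef := by
  choose m hm hV using fun j => (hP.V_posDef i j).inv.exists_smul_one_le
  have hc : ∀ᶠ c : ℝ in 𝓝[>] 0, ∀ j, c ≤ p i j * m j := by
    rw [eventually_all]
    intro j
    filter_upwards [Ioo_mem_nhdsGT (mul_pos (hp j) (hm j))] with c hc using hc.2.le
  obtain ⟨c, hc, hc0⟩ := (hc.and self_mem_nhdsWithin).exists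
  have hc0' : 0 < c := hc0
  refine ⟨c, hc0', posSemidef_iff_real.2 ⟨?_, fun x => ?_⟩⟩
  · refine (hP.info_posSemidef fun j => (hp j).le).isHermitian.sub ?_
    have := (posSemidef_conjTranspose_mul_self (P.stackedC i J)).smul hc0'.le
    simpa using this.isHermitian
  · have h0 : ∀ j, 0 ≤ (P.C i j *ᵥ x) ⬝ᵥ (P.C i j *ᵥ x) := fun j => by
      simpa using dotProduct_star_self_nonneg (P.C i j *ᵥ x)
    have h1 : ∀ j, c * ((P.C i j *ᵥ x) ⬝ᵥ (P.C i j *ᵥ x)) ≤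
        p i j * ((P.C i j *ᵥ x) ⬝ᵥ (P.V i j)⁻¹ *ᵥ (P.C i j *ᵥ x)) := fun j =>
      (mul_le_mul_of_nonneg_right (hc j) (h0 j)).trans (by
        rw [mul_assoc]
        exact mul_le_mul_of_nonneg_left (hV j _) (hp j).le)
    rw [sub_mulVec, dotProduct_sub, smul_mulVec, dotProduct_smul, smul_eq_mul, quadratic_stackedC,
      quadratic_info, sub_nonneg, Finset.mul_sum]
    refine (Finset.sum_le_sum fun j _ => h1 j).trans ?_
    exact Finset.sum_le_sum_of_subset_of_nonneg (Finset.subset_univ J) fun j _ _ =>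
      (mul_nonneg hc0'.le (h0 j)).trans (h1 j)

theorem StandingAssumptions.exists_strictlyFeasible (hP : P.StandingAssumptions)
    (hbusy : busy → M ≤ N) (hcovered : covered → N ≤ M) :
    ∃ (Q : P.Matrices) (p : Fin N → Fin M → ℝ), IsSubstochastic busy covered p ∧
      (∀ i, (Q i).PosDef) ∧ ∀ i, (-(Q i * P.A i + (P.A i).transpose * Q i +
        Q i * P.W i * Q i - P.info p i)).PosDef := by
  set p : Fin N → Fin M → ℝ := fun _ _ => ((max N M : ℕ) : ℝ)⁻¹ with hp
  have h : ∀ i, ∃ Q : Matrix (Fin (P.n i)) (Fin (P.n i)) ℝ, Q.PosDef ∧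
      (-(Q * P.A i + (P.A i).transpose * Q + Q * P.W i * Q - P.info p i)).PosDef := fun i => by
    obtain ⟨J, hJ⟩ := hP.detectable i
    have hp0 : ∀ j, 0 < p i j := fun j => by
      have : 0 < max N M := lt_max_of_lt_left (Nat.zero_lt_of_lt i.2)
      simp only [hp]
      positivity
    obtain ⟨c, hc, hcΓ⟩ := hP.exists_stackedC_le_info hp0 J
    exact hJ.exists_strict_riccati (hP.W_posSemidef i) hc hcΓ
  choose Q hQ hQ' using h
  exact ⟨Q, p, IsSubstochastic.uniform hbusy hcovered, hQ, hQ'⟩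

theorem StandingAssumptions.riccatiObjective_le (hP : P.StandingAssumptions) {X Y : P.Matrices}
    (hX : ∀ i, (X i).PosDef) (hY : ∀ i, (Y i).PosDef) (p q : Fin N → Fin M → ℝ) {a b : ℝ}
    (ha : 0 ≤ a) (hb : 0 ≤ b) (hab : a + b = 1) :
    P.riccatiObjective (a • X + b • Y, a • p + b • q) ≤
      a * P.riccatiObjective (X, p) + b * P.riccatiObjective (Y, q) := by
  simp only [riccatiObjective, Finset.mul_sum, ← Finset.sum_add_distrib]
  refine Finset.sum_le_sum fun i _ => ?_
  have h := trace_mul_le_of_posSemidef_sub (hP.T_posSemidef i)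
    (posSemidef_convexCombination_inv_sub (hX i) (hY i) ha hb hab)
  rw [mul_add, trace_add, mul_smul_comm, mul_smul_comm, trace_smul, trace_smul, smul_eq_mul,
    smul_eq_mul] at h
  have h2 : ∑ j, P.κ i j * (a • p + b • q) i j =
      a * ∑ j, P.κ i j * p i j + b * ∑ j, P.κ i j * q i j := by
    rw [Finset.mul_sum, Finset.mul_sum, ← Finset.sum_add_distrib]
    refine Finset.sum_congr rfl fun j _ => ?_
    simp only [Pi.add_apply, Pi.smul_apply, smul_eq_mul]
    ring
  have h3 : ((a • X + b • Y) i)⁻¹ = (a • X i + b • Y i)⁻¹ := rfl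
  simp only [h2, h3]
  linarith

theorem StandingAssumptions.convexOn_riccatiObjective (hP : P.StandingAssumptions) :
    ConvexOn ℝ (P.riccatiFeasible busy covered) P.riccatiObjective := by
  refine ⟨?_, ?_⟩
  · rintro ⟨X, p⟩ ⟨hX, hXr, hp⟩ ⟨Y, q⟩ ⟨hY, hYr, hq⟩ a b ha hb hab
    refine ⟨fun i => (hX i).convexCombination (hY i) ha hb hab, fun i => ?_,
      hp.convexCombination hq ha hb hab⟩
    have h := posSemidef_riccati_sub_convexCombination (A := P.A i) (Γ₁ := P.info p i)
      (Γ₂ := P.info q i) (hP.W_posSemidef i) (hX i).isHermitian (hY i).isHermitian ha hb hab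
    rw [← info_convexCombination] at h
    have h2 := h.add (((hXr i).smul ha).add ((hYr i).smul hb))
    rwa [sub_add_cancel] at h2
  · rintro ⟨X, p⟩ ⟨hX, -⟩ ⟨Y, q⟩ ⟨hY, -⟩ a b ha hb hab
    exact hP.riccatiObjective_le hX hY p q ha hb hab

theorem convexOn_lmiObjective : ConvexOn ℝ (P.lmiFeasible busy covered) P.lmiObjective := by
  refine ⟨?_, ?_⟩
  · rintro ⟨R, X, p⟩ ⟨hX, hXr, hp⟩ ⟨U, Y, q⟩ ⟨hY, hYr, hq⟩ a b ha hb hab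
    have h1 : ∀ {m : Type} (D : Matrix m m ℝ), D = a • D + b • D := fun D => by
      rw [← add_smul, hab, one_smul]
    refine ⟨fun i => ?_, fun i => ?_, hp.convexCombination hq ha hb hab⟩
    · have := (hX i).convexCombination (hY i) ha hb hab
      rw [fromBlocks_smul, fromBlocks_smul, fromBlocks_add, ← h1] at this
      exact this
    · have := ((hXr i).smul ha).add ((hYr i).smul hb)
      rw [smul_neg, smul_neg, ← neg_add, fromBlocks_smul, fromBlocks_smul, fromBlocks_add,
        ← h1] at this
      refine Eq.mp (congrArg Matrix.PosSemidef ?_) this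
      simp only [Prod.smul_mk, Prod.mk_add_mk, info_convexCombination]
      simp only [Pi.add_apply, Pi.smul_apply]
      congr 2
      · simp only [add_mul, mul_add, smul_mul_assoc, mul_smul_comm, smul_add, smul_sub]
        abel
      · simp only [add_mul, smul_mul_assoc]
      · simp only [mul_add, mul_smul_comm]
  · rintro ⟨R, X, p⟩ - ⟨U, Y, q⟩ - a b ha hb hab
    refine le_of_eq ?_
    simp only [lmiObjective, smul_eq_mul, Finset.mul_sum, ← Finset.sum_add_distrib,
      Prod.smul_mk, Prod.mk_add_mk, Pi.add_apply, Pi.smul_apply, mul_add, mul_smul_comm,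
      trace_add, trace_smul]
    refine Finset.sum_congr rfl fun i _ => ?_
    simp only [Finset.sum_add_distrib]
    have : ∀ (c : ℝ) (r : Fin N → Fin M → ℝ),
        ∑ j, P.κ i j * (c * r i j) = ∑ j, c * (P.κ i j * r i j) :=
      fun c r => Finset.sum_congr rfl fun j _ => by ring
    rw [this, this]
    ring

theorem StandingAssumptions.mem_lmiFeasible_iff (hP : P.StandingAssumptions)
    {R Q : P.Matrices} {p : Fin N → Fin M → ℝ} :
    (R, Q, p) ∈ P.lmiFeasible busy covered ↔
      (Q, p) ∈ P.riccatiFeasible busy covered ∧ ∀ i, (R i - (Q i)⁻¹).PosDef := by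
  have key : ∀ i, (Q i).PosDef → ((-(fromBlocks
      (Q i * P.A i + (P.A i).transpose * Q i - P.info p i) (Q i * matrixSqrt (P.W i))
      (matrixSqrt (P.W i) * Q i) (-1))).PosSemidef ↔
      (-(Q i * P.A i + (P.A i).transpose * Q i + Q i * P.W i * Q i - P.info p i)).PosSemidef) :=
    fun i hQ => by
      obtain ⟨h1, h2⟩ := matrixSqrt_spec (hP.W_posSemidef i)
      rw [posSemidef_neg_fromBlocks_iff hQ.isHermitian h1.isHermitian h2, sub_add_eq_add_sub]
  constructor
  · rintro ⟨h1, h2, h3⟩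
    have h1' := fun i => posDef_fromBlocks_one_iff.1 (h1 i)
    exact ⟨⟨fun i => (h1' i).1, fun i => (key i (h1' i).1).1 (h2 i), h3⟩, fun i => (h1' i).2⟩
  · rintro ⟨⟨h1, h2, h3⟩, h4⟩
    exact ⟨fun i => posDef_fromBlocks_one_iff.2 ⟨h1 i, h4 i⟩, fun i => (key i (h1 i)).2 (h2 i), h3⟩

theorem StandingAssumptions.exists_lmiFeasible (hP : P.StandingAssumptions)
    {Q : P.Matrices} {p : Fin N → Fin M → ℝ} (h : (Q, p) ∈ P.riccatiFeasible busy covered)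
    {ε : ℝ} (hε : 0 < ε) :
    (fun i => (Q i)⁻¹ + ε • 1, Q, p) ∈ P.lmiFeasible busy covered :=
  hP.mem_lmiFeasible_iff.2 ⟨h, fun i => by
    rw [add_sub_cancel_left]
    exact PosDef.one.smul hε⟩

/-- Strictness forces R ≻ Q⁻¹, so R = Q⁻¹ is not allowed; R = Q⁻¹ + εI costs an extra ε ∑ Tr Tᵢ,
which vanishes as ε → 0. -/
theorem StandingAssumptions.lmiValue_eq_riccatiValue (hP : P.StandingAssumptions) :
    P.lmiValue busy covered = P.riccatiValue busy covered := by
  refine le_antisymm (le_iInf₂ fun x hx => ?_) (le_iInf₂ fun y hy => ?_)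
  · obtain ⟨Q, p⟩ := x
    have h1 : ∀ ε : ℝ, 0 < ε → P.lmiValue busy covered ≤
        ((P.riccatiObjective (Q, p) + ε * ∑ i, (P.T i).trace : ℝ) : EReal) := fun ε hε => by
      refine (iInf₂_le _ (hP.exists_lmiFeasible hx hε)).trans_eq ?_
      congr 1
      simp only [lmiObjective, riccatiObjective, Finset.mul_sum, ← Finset.sum_add_distrib]
      refine Finset.sum_congr rfl fun i _ => ?_
      rw [mul_add, trace_add, mul_smul_comm, mul_one, trace_smul, smul_eq_mul]
      ring
    have h2 : Tendsto (fun ε : ℝ =>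
        ((P.riccatiObjective (Q, p) + ε * ∑ i, (P.T i).trace : ℝ) : EReal)) (𝓝[>] 0)
        (𝓝 ((P.riccatiObjective (Q, p) + 0 * ∑ i, (P.T i).trace : ℝ) : EReal)) :=
      tendsto_nhdsWithin_of_tendsto_nhds
        (Continuous.tendsto (continuous_coe_real_ereal.comp (by fun_prop)) 0)
    rw [zero_mul, add_zero] at h2
    refine ge_of_tendsto h2 ?_
    filter_upwards [self_mem_nhdsWithin] with ε hε using h1 ε hε
  · obtain ⟨R, Q, p⟩ := y
    obtain ⟨h1, h2⟩ := hP.mem_lmiFeasible_iff.1 hy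
    refine (iInf₂_le _ h1).trans (EReal.coe_le_coe_iff.2 ?_)
    exact Finset.sum_le_sum fun i _ => add_le_add_left
      (trace_mul_le_of_posSemidef_sub (hP.T_posSemidef i) (h2 i).posSemidef) _

theorem StandingAssumptions.exists_riccatiValue_eq (hP : P.StandingAssumptions)
    (hbusy : busy → M ≤ N) (hcovered : covered → N ≤ M) :
    ∃ z : ℝ, P.riccatiValue busy covered = (z : EReal) := by
  obtain ⟨Q, p, hp, hQ, hQ'⟩ := hP.exists_strictlyFeasible hbusy hcovered
  have hle : P.riccatiValue busy covered ≤ ((P.riccatiObjective (Q, p) : ℝ) : EReal) :=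
    iInf₂_le (Q, p) ⟨hQ, fun i => (hQ' i).posSemidef, hp⟩
  have hge : ((-∑ i, ∑ j, |P.κ i j| : ℝ) : EReal) ≤ P.riccatiValue busy covered := by
    refine le_iInf₂ fun x hx => EReal.coe_le_coe_iff.2 ?_
    rw [← Finset.sum_neg_distrib]
    refine Finset.sum_le_sum fun i _ => ?_
    have h1 := (hP.T_posSemidef i).trace_mul_nonneg (hx.1 i).inv.posSemidef
    have h2 : -∑ j, |P.κ i j| ≤ ∑ j, P.κ i j * x.2 i j := by
      rw [← Finset.sum_neg_distrib]
      refine Finset.sum_le_sum fun j _ => ?_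
      have h3 := hx.2.2.nonneg i j
      have h4 := hx.2.2.le_one i j
      nlinarith [neg_abs_le (P.κ i j), abs_nonneg (P.κ i j)]
    linarith
  exact ⟨_, (EReal.coe_toReal (hle.trans_lt (EReal.coe_lt_top _)).ne
    ((EReal.bot_lt_coe _).trans_le hge).ne').symm⟩

end SchedulingProblem

/-! ### From schedules to almost feasible points and the lower bound. -/

namespace SchedulingProblem

variable {N M : ℕ} {P : SchedulingProblem N M} {busy covered : Prop}
  {π : ℝ → Fin N → Fin M → ℝ} {S : ℝ → (i : Fin N) → Matrix (Fin (P.n i)) (Fin (P.n i)) ℝ}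

theorem IsSchedule.abs_le_one (hπ : IsSchedule busy covered π) {t : ℝ} (ht : 0 ≤ t) (i : Fin N)
    (j : Fin M) : |π t i j| ≤ 1 := by
  have h := hπ.constraints t ht
  rw [abs_of_nonneg (h.nonneg i j)]
  exact h.le_one i j

theorem IsSchedule.measurable_entry (hπ : IsSchedule busy covered π) (i : Fin N) (j : Fin M) :
    Measurable fun t => π (max t 0) i j := by
  have h := hπ.measurable.comp
    (measurable_id.max measurable_const : Measurable fun t : ℝ => max t 0)
  exact (measurable_pi_apply j).comp ((measurable_pi_apply i).comp h)

theorem IsSchedule.intervalIntegrable (hπ : IsSchedule busy covered π) {τ : ℝ} (hτ : 0 ≤ τ)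
    (i : Fin N) (j : Fin M) : IntervalIntegrable (fun t => π t i j) volume 0 τ := by
  refine ((hπ.measurable_entry i j).intervalIntegrable_of_abs_le
    (fun t => hπ.abs_le_one (le_max_right t 0) i j) 0 τ).congr fun t ht => ?_
  rw [uIoc_of_le hτ] at ht
  simp only [max_eq_left ht.1.le]

/-- Freezing time at `max t 0` makes the boundedness, positivity and continuity conditions hold on
all of ℝ, although the data are constrained only for t ≥ 0. -/
theorem IsErrorCovariance.isRiccatiFlow (hP : P.StandingAssumptions)
    (hπ : IsSchedule busy covered π) (hS : P.IsErrorCovariance π S) (i : Fin N) :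
    IsRiccatiFlow (P.A i) (P.W i) (P.S0 i) (fun t => P.info (π (max t 0)) i)
      (fun t => S (max t 0) i) where
  W_posSemidef := hP.W_posSemidef i
  S0_posDef := hP.S0_posDef i
  measurable a b := by
    simp only [info, Matrix.sum_apply, Matrix.smul_apply, smul_eq_mul]
    exact Finset.measurable_sum _ fun j _ => (hπ.measurable_entry i j).mul_const _
  bounded := by
    set K : Fin M → Matrix (Fin (P.n i)) (Fin (P.n i)) ℝ :=
      fun j => (P.C i j).transpose * (P.V i j)⁻¹ * P.C i j with hK
    refine ⟨∑ a, ∑ b, ∑ j, |K j a b|, fun t a b => ?_⟩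
    have h1 : |P.info (π (max t 0)) i a b| ≤ ∑ j, |K j a b| := by
      simp only [info, Matrix.sum_apply, Matrix.smul_apply, smul_eq_mul]
      refine (Finset.abs_sum_le_sum_abs _ _).trans (Finset.sum_le_sum fun j _ => ?_)
      rw [abs_mul]
      exact mul_le_of_le_one_left (abs_nonneg _) (hπ.abs_le_one (le_max_right t 0) i j)
    refine h1.trans ?_
    refine (Finset.single_le_sum (f := fun b => ∑ j, |K j a b|) (fun b _ => by positivity)
      (Finset.mem_univ b)).trans ?_
    exact Finset.single_le_sum (f := fun a => ∑ b, ∑ j, |K j a b|) (fun a _ => by positivity)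
      (Finset.mem_univ a)
  posSemidef t := hP.info_posSemidef fun j => (hπ.constraints _ (le_max_right t 0)).nonneg i j
  continuous := by
    have h : Continuous fun t : ℝ => S (max t 0) := hS.continuousOn.comp_continuous
      (continuous_id.max continuous_const) fun t => le_max_right t 0
    exact (continuous_apply i).comp h
  riccati t ht := by
    ext a b
    rw [max_eq_left ht, hS.riccati t ht i a b, Matrix.add_apply]
    congr 1
    refine intervalIntegral.integral_congr fun s hs => ?_
    rw [uIcc_of_le ht] at hs
    simp only [max_eq_left hs.1]

theorem info_average (hπ : IsSchedule busy covered π) {τ : ℝ} (hτ : 0 ≤ τ) (i : Fin N) :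
    P.info (fun i j => τ⁻¹ * ∫ t in (0 : ℝ)..τ, π t i j) i =
      τ⁻¹ • entryIntegral (fun t => P.info (π (max t 0)) i) 0 τ := by
  ext a b
  simp only [entryIntegral, info, Matrix.sum_apply, Matrix.smul_apply, smul_eq_mul, of_apply]
  rw [intervalIntegral.integral_finsetSum, Finset.mul_sum]
  · refine Finset.sum_congr rfl fun j _ => ?_
    rw [intervalIntegral.integral_mul_const, mul_assoc]
    congr 2
    refine intervalIntegral.integral_congr fun t ht => ?_
    rw [uIcc_of_le hτ] at ht
    simp only [max_eq_left ht.1]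
  · intro j _
    exact ((hπ.measurable_entry i j).intervalIntegrable_of_abs_le
      (fun t => hπ.abs_le_one (le_max_right t 0) i j) 0 τ).mul_const _

theorem averageCost_eq (hπ : IsSchedule busy covered π) (hS : P.IsErrorCovariance π S) {τ : ℝ}
    (hτ : 0 ≤ τ) : P.averageCost π S τ =
      ∑ i, (τ⁻¹ * (∫ t in (0 : ℝ)..τ, (P.T i * S (max t 0) i).trace) +
        ∑ j, P.κ i j * (τ⁻¹ * ∫ t in (0 : ℝ)..τ, π t i j)) := by
  have hcont : ∀ i, Continuous fun t : ℝ => (P.T i * S (max t 0) i).trace := fun i => by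
    have h : Continuous fun t : ℝ => S (max t 0) := hS.continuousOn.comp_continuous
      (continuous_id.max continuous_const) fun t => le_max_right t 0
    exact (continuous_const.matrix_mul ((continuous_apply i).comp h)).matrix_trace
  have hκ : ∀ i, IntervalIntegrable (fun t => ∑ j, P.κ i j * π t i j) volume 0 τ := fun i => by
    have := IntervalIntegrable.sum Finset.univ fun j (_ : j ∈ Finset.univ) =>
      (hπ.intervalIntegrable hτ i j).const_mul (P.κ i j)
    simpa [Finset.sum_fn] using this
  have h1 : ∫ t in (0 : ℝ)..τ, ∑ i, ((P.T i * S t i).trace + ∑ j, P.κ i j * π t i j) =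
      ∫ t in (0 : ℝ)..τ, ∑ i, ((P.T i * S (max t 0) i).trace + ∑ j, P.κ i j * π t i j) := by
    refine intervalIntegral.integral_congr fun t ht => ?_
    rw [uIcc_of_le hτ] at ht
    simp only [max_eq_left ht.1]
  rw [averageCost, h1, intervalIntegral.integral_finsetSum fun i _ =>
    ((hcont i).intervalIntegrable 0 τ).add (hκ i), Finset.mul_sum, one_div]
  refine Finset.sum_congr rfl fun i _ => ?_
  rw [intervalIntegral.integral_add ((hcont i).intervalIntegrable 0 τ) (hκ i), mul_add,
    intervalIntegral.integral_finsetSum fun j _ =>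
      (hπ.intervalIntegrable hτ i j).const_mul (P.κ i j), Finset.mul_sum]
  congr 1
  refine Finset.sum_congr rfl fun j _ => ?_
  rw [intervalIntegral.integral_const_mul]
  ring

/-- Time averages of a schedule give points that violate the Riccati inequalities by an error of
order `1 / τ` only, and whose objective is at most the average cost. -/
theorem exists_almostFeasible (hP : P.StandingAssumptions) (hπ : IsSchedule busy covered π)
    (hS : P.IsErrorCovariance π S) {τ : ℝ} (hτ : 0 < τ) :
    ∃ (Q : P.Matrices) (p : Fin N → Fin M → ℝ), IsSubstochastic busy covered p ∧
      (∀ i, (Q i).PosDef) ∧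
      (∀ i, (τ⁻¹ • (P.S0 i)⁻¹ - (Q i * P.A i + (P.A i).transpose * Q i + Q i * P.W i * Q i
        - P.info p i)).PosSemidef) ∧
      P.riccatiObjective (Q, p) ≤ P.averageCost π S τ := by
  choose Q hQ hQr hQT using fun i => (hS.isRiccatiFlow hP hπ i).exists_average hτ
  refine ⟨Q, fun i j => τ⁻¹ * ∫ t in (0 : ℝ)..τ, π t i j,
    IsSubstochastic.average hτ (hπ.intervalIntegrable hτ.le) fun t ht => hπ.constraints t ht.1,
    hQ, fun i => ?_, ?_⟩
  · rw [info_average hπ hτ.le]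
    exact hQr i
  · rw [averageCost_eq hπ hS hτ.le]
    exact Finset.sum_le_sum fun i _ => add_le_add_left (hQT i _ (hP.T_posSemidef i)) _

/-- K is the objective at the Slater point and does not depend on θ or τ. For fixed θ, the slack of
that point, weighted by θ, absorbs (1 - θ)Σ₀⁻¹/τ for large τ, so the mixture is exactly feasible. -/
theorem StandingAssumptions.eventually_le_averageCost (hP : P.StandingAssumptions)
    (hbusy : busy → M ≤ N) (hcovered : covered → N ≤ M) (hπ : IsSchedule busy covered π)
    (hS : P.IsErrorCovariance π S) {z : ℝ} (hz : P.riccatiValue busy covered = (z : EReal)) :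
    ∃ K : ℝ, ∀ θ : ℝ, 0 < θ → θ < 1 →
      ∀ᶠ τ in atTop, z ≤ (1 - θ) * P.averageCost π S τ + θ * K := by
  obtain ⟨Q', p', hp', hQ', hr'⟩ := hP.exists_strictlyFeasible hbusy hcovered
  refine ⟨P.riccatiObjective (Q', p'), fun θ h0 h1 => ?_⟩
  choose ε hε hεpd using fun i => ((hr' i).smul h0).exists_sub_smul
    ((hP.S0_posDef i).inv.isHermitian)
  have hlim : Tendsto (fun τ : ℝ => (1 - θ) * τ⁻¹) atTop (𝓝 0) := by
    simpa using tendsto_inv_atTop_zero.const_mul (1 - θ)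
  have hev : ∀ᶠ τ in atTop, ∀ i, (1 - θ) * τ⁻¹ < ε i :=
    eventually_all.2 fun i => hlim.eventually_lt_const (hε i)
  filter_upwards [hev, eventually_gt_atTop 0] with τ hτε hτ
  obtain ⟨Q, p, hp, hQ, hr, hobj⟩ := exists_almostFeasible hP hπ hS hτ
  have h1' : 0 ≤ 1 - θ := by linarith
  have hsum : 1 - θ + θ = 1 := by ring
  have hmix : ((1 - θ) • Q + θ • Q', (1 - θ) • p + θ • p') ∈ P.riccatiFeasible busy covered := by
    refine ⟨fun i => (hQ i).convexCombination (hQ' i) h1' h0.le hsum, fun i => ?_,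
      hp.convexCombination hp' h1' h0.le hsum⟩
    have h2 := posSemidef_riccati_sub_convexCombination (A := P.A i) (Γ₁ := P.info p i)
      (Γ₂ := P.info p' i) (hP.W_posSemidef i) (hQ i).isHermitian (hQ' i).isHermitian h1' h0.le hsum
    rw [← info_convexCombination] at h2
    have h3 := (hεpd i ((1 - θ) * τ⁻¹) (mul_nonneg h1' (inv_nonneg.2 hτ.le))
      (hτε i).le).posSemidef
    have h4 := h2.add (((hr i).smul h1').add h3)
    refine Eq.mp (congrArg Matrix.PosSemidef ?_) h4
    simp only [Pi.add_apply, Pi.smul_apply]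
    simp only [smul_sub, smul_smul, smul_neg]
    abel
  have hsplit := hP.riccatiObjective_le hQ hQ' p p' h1' h0.le hsum
  have hz' : z ≤ P.riccatiObjective ((1 - θ) • Q + θ • Q', (1 - θ) • p + θ • p') := by
    rw [← EReal.coe_le_coe_iff, ← hz]
    exact iInf₂_le _ hmix
  have := mul_le_mul_of_nonneg_left hobj h1'
  linarith

theorem StandingAssumptions.riccatiValue_le_longRunCost (hP : P.StandingAssumptions)
    (hbusy : busy → M ≤ N) (hcovered : covered → N ≤ M) (hπ : IsSchedule busy covered π)
    (hS : P.IsErrorCovariance π S) : P.riccatiValue busy covered ≤ P.longRunCost π S := by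
  obtain ⟨z, hz⟩ := hP.exists_riccatiValue_eq hbusy hcovered
  obtain ⟨K, hK⟩ := hP.eventually_le_averageCost hbusy hcovered hπ hS hz
  rw [hz]
  refine le_of_forall_lt fun c hc => ?_
  obtain ⟨b, hcb, hbz⟩ := EReal.lt_iff_exists_real_btwn.1 hc
  refine hcb.trans_le ?_
  have hbz' : b < z := EReal.coe_lt_coe_iff.1 hbz
  set d := 1 + |K - b| with hd
  have hd0 : 0 < d := by positivity
  -- Chosen so that θ(K - b) ≤ z - b, which turns z ≤ (1 - θ)·(average cost) + θK into b ≤ (average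
  -- cost).
  set θ := min (1 / 2) ((z - b) / d) with hθ
  have hθ0 : 0 < θ := lt_min (by norm_num) (div_pos (by linarith) hd0)
  have hθ1 : θ < 1 := (min_le_left _ _).trans_lt (by norm_num)
  have hθd : θ * d ≤ z - b := by
    rw [← le_div_iff₀ hd0]
    exact min_le_right _ _
  have hev : ∀ᶠ τ in atTop, (b : EReal) ≤ (P.averageCost π S τ : EReal) := by
    filter_upwards [hK θ hθ0 hθ1] with τ hτ
    rw [EReal.coe_le_coe_iff]
    have h1 : θ * (K - b) ≤ z - b := by
      refine le_trans (mul_le_mul_of_nonneg_left ?_ hθ0.le) hθd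
      linarith [le_abs_self (K - b)]
    have h2 : (1 - θ) * b ≤ (1 - θ) * P.averageCost π S τ := by linarith
    exact le_of_mul_le_mul_left h2 (by linarith)
  exact le_limsup_of_frequently_le hev.frequently

end SchedulingProblem

end

theorem mainTheorem2 {N M : ℕ} (P : SchedulingProblem N M) (hP : P.StandingAssumptions)
    (busy covered : Prop) (hbusy : busy → M ≤ N) (hcovered : covered → N ≤ M) :
    -- the program with Riccati inequalities is convex and has a finite optimal value
    ConvexOn ℝ (P.riccatiFeasible busy covered) P.riccatiObjective ∧
    (∃ z : ℝ, P.riccatiValue busy covered = (z : EReal)) ∧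
    -- it can be rewritten as a convex program with linear matrix inequalities
    ConvexOn ℝ (P.lmiFeasible busy covered) P.lmiObjective ∧
    (∀ Q p, (Q, p) ∈ P.riccatiFeasible busy covered ↔
      ∃ R, (R, Q, p) ∈ P.lmiFeasible busy covered) ∧
    P.lmiValue busy covered = P.riccatiValue busy covered ∧
    -- its optimal value is a lower bound on the long-run average cost of every schedule
    (∀ (π : ℝ → Fin N → Fin M → ℝ)
      (S : ℝ → (i : Fin N) → Matrix (Fin (P.n i)) (Fin (P.n i)) ℝ),
      SchedulingProblem.IsSchedule busy covered π → P.IsErrorCovariance π S →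
      P.lmiValue busy covered ≤ P.longRunCost π S) := by
  exact ⟨hP.convexOn_riccatiObjective, hP.exists_riccatiValue_eq hbusy hcovered,
    SchedulingProblem.convexOn_lmiObjective,
    fun _ _ => ⟨fun h => ⟨_, hP.exists_lmiFeasible h one_pos⟩,
      fun ⟨_, h⟩ => (hP.mem_lmiFeasible_iff.1 h).1⟩,
    hP.lmiValue_eq_riccatiValue,
    fun _ _ hπ hS => hP.lmiValue_eq_riccatiValue.trans_le
      (hP.riccatiValue_le_longRunCost hbusy hcovered hπ hS)⟩
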